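/- Let $G$ be a (Hausdorff) locally compact group which is separable (has a countable dense subset) and compactly generated, let $S\subset G$ be a compact symmetric generating set containing the identity, fix a left Haar measure $dg$ on $G$, and fix $M>1$. A representation $(\pi,E)$ of $G$ is a strongly continuous homomorphism $\pi$ from $G$ to the group of bounded invertible operators of a complex Banach space $E$; two representations are equivalent if a surjective linear isometry intertwines them. Put $E^\pi=\{x\in E:\pi(g)x=x\ \forall g\in G\}$ and, for $f\in C_c(G)$, $\pi(f)x=\int_G f(g)\pi(g)x\,dg$. $H^1(G,\pi)=Z^1(G,\pi)/B^1(G,\pi)$, where $Z^1(G,\pi)$ is the space of continuous maps $b:G\to E$ with $b(gh)=b(g)+\pi(g)b(h)$ and $B^1(G,\pi)$ is the space of the maps $g\mapsto x-\pi(g)x$, $x\in E$. Let $\mathcal R$ be the set of equivalence classes of representations $(\pi,E)$ of $G$ with $E$ separable and $\sup_{g\in S}\|\pi(g)\|\le M$. Equip $\mathcal R$ with the topology with basis the sets $W_{x_1,\dots,x_n,Q,\varepsilon}(\pi,E)$, for $(\pi,E)\in\mathcal R$, $x_1,\dots,x_n\in E$, $Q\subset G$ compact, $\varepsilon>0$,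 where $W_{x_1,\dots,x_n,Q,\varepsilon}(\pi,E)$ is the set of $(\pi',E')\in\mathcal R$ for which there are $x_1',\dots,x_n'\in E'$ with $$\sup_{f_1,\dots,f_n}\Big|\,\Big\|\sum_{k=1}^n\pi'(f_k)x_k'\Big\|-\Big\|\sum_{k=1}^n\pi(f_k)x_k\Big\|\,\Big|<\varepsilon,$$ the supremum being over all $f_1,\dots,f_n\in C_c(G)$ supported in $Q$ with $\|f_k\|_{L_1}\le1$. For subsets $A,B$ of a topological space $X$, $B$ is a strong neighbourhood of $A$ if $B$ belongs to every ultrafilter on $X$ all of whose accumulation points lie in $A$. For $\mathcal F\subset\mathcal R$, let $\mathcal C_{\mathcal F}(G)$ be the completion of $C_c(G)$ for the seminorm $\|f\|_{\mathcal F}=\sup_{(\pi,E)\in\mathcal F}\|\pi(f)\|$, a Banach algebra for convolution to which every $\pi$ in $\mathcal F$ extends. A Kazhdan projection in $\mathcal C_{\mathcal F}(G)$ is an idempotent $p$ in the closure of $\{f\in C_c(G):\int f=1\}$ such that $\pi(p)$ is a projection onto $E^\pi$ for every $(\pi,E)\in\mathcal F$. Theorem. Let $\mathcal F\subset\mathcal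 R$. Assume that $\mathcal C_{\mathcal F}(G)$ has a Kazhdan projection and that $H^1(G,\pi)=0$ for all $(\pi,E)\in\mathcal F$. Then there is a strong neighbourhood $\mathcal F'\subset\mathcal R$ of $\mathcal F$ such that $\mathcal C_{\mathcal F'}(G)$ has a Kazhdan projection and $H^1(G,\pi)=0$ for all $(\pi,E)\in\mathcal F'$. -/

import Mathlib

open MeasureTheory Topology UniformSpace
open scoped CompactlySupported Pointwise

universe u v

noncomputable section

/-- A strongly continuous representation of `G` on a complex Banach space. (A monoid homomorphism
from a group into the bounded operators takes its values in the invertible ones.) -/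
structure BanachRep (G : Type u) [Group G] [TopologicalSpace G] : Type (max u (v + 1)) where
  E : Type v
  [normedAddCommGroup : NormedAddCommGroup E]
  [normedSpace : NormedSpace ℂ E]
  [completeSpace : CompleteSpace E]
  π : G →* (E →L[ℂ] E)
  continuous_apply : ∀ x : E, Continuous fun g => π g x

attribute [instance] BanachRep.normedAddCommGroup BanachRep.normedSpace BanachRep.completeSpace

namespace BanachRep

section Basic

variable {G : Type u} [Group G] [TopologicalSpace G]

/-- Equivalence: a surjective linear isometry intertwines the two actions. -/
def Equivalent (ρ₁ ρ₂ : BanachRep.{u, v} G) : Prop :=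
  ∃ T : ρ₁.E ≃ₗᵢ[ℂ] ρ₂.E, ∀ g x, T (ρ₁.π g x) = ρ₂.π g (T x)

/-- The space `E^π` of invariant vectors. -/
def invariants (ρ : BanachRep.{u, v} G) : Submodule ℂ ρ.E where
  carrier := {x | ∀ g, ρ.π g x = x}
  add_mem' := by
    intro x y hx hy g
    rw [map_add, hx g, hy g]
  zero_mem' := fun g => map_zero _
  smul_mem' := by
    intro c x hx g
    rw [map_smul, hx g]

/-- `Z¹(G, π)`: continuous cocycles, i.e. translation parts of the continuous affine actions with
linear part `π`. -/
def Z1 (ρ : BanachRep.{u, v} G) : Submodule ℂ (G → ρ.E) where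
  carrier := {b | Continuous b ∧ ∀ g h, b (g * h) = b g + ρ.π g (b h)}
  add_mem' := by
    rintro b c ⟨hb, hb'⟩ ⟨hc, hc'⟩
    refine ⟨hb.add hc, fun g h => ?_⟩
    simp only [Pi.add_apply, hb' g h, hc' g h, map_add]
    abel
  zero_mem' := ⟨continuous_const, fun g h => by simp⟩
  smul_mem' := by
    rintro a b ⟨hb, hb'⟩
    refine ⟨hb.const_smul a, fun g h => ?_⟩
    simp only [Pi.smul_apply, hb' g h, map_smul, smul_add]

/-- `B¹(G, π)`: the cocycles `g ↦ x - π(g) x`. -/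
def B1 (ρ : BanachRep.{u, v} G) : Submodule ℂ (G → ρ.E) where
  carrier := {b | ∃ x : ρ.E, ∀ g, b g = x - ρ.π g x}
  add_mem' := by
    rintro b c ⟨x, hx⟩ ⟨y, hy⟩
    refine ⟨x + y, fun g => ?_⟩
    simp only [Pi.add_apply, hx g, hy g, map_add]
    abel
  zero_mem' := ⟨0, fun g => by simp⟩
  smul_mem' := by
    rintro a b ⟨x, hx⟩
    refine ⟨a • x, fun g => ?_⟩
    simp only [Pi.smul_apply, hx g, map_smul, smul_sub]

/-- `H¹(G, π) = Z¹(G, π) / B¹(G, π)`. -/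
abbrev H1 (ρ : BanachRep.{u, v} G) : Type (max u v) :=
  ρ.Z1 ⧸ ρ.B1.submoduleOf ρ.Z1

theorem exists_bound_on_compact (ρ : BanachRep.{u, v} G) {K : Set G} (hK : IsCompact K) :
    ∃ C, ∀ g ∈ K, ‖ρ.π g‖ ≤ C := by
  obtain ⟨C, hC⟩ := banach_steinhaus (g := fun g : K => ρ.π g) (fun x => by
    obtain ⟨C, hC⟩ := hK.exists_bound_of_continuousOn (ρ.continuous_apply x).continuousOn
    exact ⟨C, fun g => hC g g.2⟩)
  exact ⟨C, fun g hg => hC ⟨g, hg⟩⟩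

end Basic

section Operators

variable {G : Type u} [Group G] [TopologicalSpace G] [IsTopologicalGroup G]
  [MeasurableSpace G] [BorelSpace G] (μ : Measure G) [μ.IsHaarMeasure]

theorem integrable_smul (ρ : BanachRep.{u, v} G) (f : C_c(G, ℂ)) (x : ρ.E) :
    Integrable (fun g => f g • ρ.π g x) μ :=
  (f.continuous.smul (ρ.continuous_apply x)).integrable_of_hasCompactSupport
    f.hasCompactSupport.smul_right

theorem norm_integral_le (ρ : BanachRep.{u, v} G) (f : C_c(G, ℂ)) {C : ℝ}
    (hC : ∀ g ∈ tsupport f, ‖ρ.π g‖ ≤ C) (x : ρ.E) :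
    ‖∫ g, f g • ρ.π g x ∂μ‖ ≤ ((∫ g, ‖f g‖ ∂μ) * C) * ‖x‖ := by
  have hf : Integrable (fun g => ‖f g‖) μ :=
    (f.continuous.integrable_of_hasCompactSupport f.hasCompactSupport).norm
  rw [mul_assoc, ← integral_mul_const]
  refine norm_integral_le_of_norm_le (hf.mul_const _) (Filter.Eventually.of_forall fun g => ?_)
  rw [norm_smul]
  by_cases hg : g ∈ tsupport f
  · exact mul_le_mul_of_nonneg_left
      ((ρ.π g).le_of_opNorm_le (hC g hg) x) (norm_nonneg _)
  · simp [image_eq_zero_of_notMem_tsupport hg]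

/-- The operator `π(f) : x ↦ ∫ f(g) π(g) x dg`. -/
def op (ρ : BanachRep.{u, v} G) (f : C_c(G, ℂ)) : ρ.E →L[ℂ] ρ.E :=
  LinearMap.mkContinuousOfExistsBound
    { toFun := fun x => ∫ g, f g • ρ.π g x ∂μ
      map_add' := fun x y => by
        simp only [map_add, smul_add]
        exact integral_add (ρ.integrable_smul μ f x) (ρ.integrable_smul μ f y)
      map_smul' := fun c x => by
        simp only [map_smul, RingHom.id_apply]
        rw [← integral_smul]
        exact integral_congr_ae (Filter.Eventually.of_forall fun g => smul_comm _ _ _) }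
    (by
      obtain ⟨C, hC⟩ := ρ.exists_bound_on_compact f.hasCompactSupport
      exact ⟨_, ρ.norm_integral_le μ f hC⟩)

theorem op_apply (ρ : BanachRep.{u, v} G) (f : C_c(G, ℂ)) (x : ρ.E) :
    ρ.op μ f x = ∫ g, f g • ρ.π g x ∂μ := rfl

theorem op_add (ρ : BanachRep.{u, v} G) (f₁ f₂ : C_c(G, ℂ)) :
    ρ.op μ (f₁ + f₂) = ρ.op μ f₁ + ρ.op μ f₂ := by
  ext x
  simp only [op_apply, _root_.add_apply, CompactlySupportedContinuousMap.add_apply,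
    add_smul]
  exact integral_add (ρ.integrable_smul μ f₁ x) (ρ.integrable_smul μ f₂ x)

theorem op_smul (ρ : BanachRep.{u, v} G) (c : ℂ) (f : C_c(G, ℂ)) :
    ρ.op μ (c • f) = c • ρ.op μ f := by
  ext x
  simp only [op_apply, _root_.smul_apply, CompactlySupportedContinuousMap.smul_apply,
    smul_assoc]
  exact integral_smul _ _

theorem norm_op_le (ρ : BanachRep.{u, v} G) (f : C_c(G, ℂ)) {C : ℝ} (hC0 : 0 ≤ C)
    (hC : ∀ g ∈ tsupport f, ‖ρ.π g‖ ≤ C) : ‖ρ.op μ f‖ ≤ (∫ g, ‖f g‖ ∂μ) * C :=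
  ContinuousLinearMap.opNorm_le_bound _
    (mul_nonneg (integral_nonneg fun _ => norm_nonneg _) hC0) (ρ.norm_integral_le μ f hC)

/-- Convolution `(f₁ * f₂)(g) = ∫ f₁(h) f₂(h⁻¹ g) dh` on `C_c(G)`. -/
def conv (f₁ f₂ : C_c(G, ℂ)) : C_c(G, ℂ) where
  toFun := fun g => ∫ h, f₁ h * f₂ (h⁻¹ * g) ∂μ
  continuous_toFun := by
    rw [← continuousOn_univ]
    refine continuousOn_integral_of_compact_support (k := tsupport f₁) f₁.hasCompactSupport ?_ ?_
    · exact Continuous.continuousOn (by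
        have h1 := f₁.continuous
        have h2 := f₂.continuous
        fun_prop)
    · intro p x _ hx
      simp [image_eq_zero_of_notMem_tsupport hx]
  hasCompactSupport' := by
    have hK : IsCompact (tsupport f₁ * tsupport f₂) :=
      f₁.hasCompactSupport.isCompact.mul f₂.hasCompactSupport.isCompact
    refine HasCompactSupport.intro' hK.closure isClosed_closure fun g hg => ?_
    have : ∀ h, f₁ h * f₂ (h⁻¹ * g) = 0 := by
      intro h
      by_contra hne
      have h1 : h ∈ tsupport f₁ := by
        by_contra h1
        exact hne (by simp [image_eq_zero_of_notMem_tsupport h1])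
      have h2 : h⁻¹ * g ∈ tsupport f₂ := by
        by_contra h2
        exact hne (by simp [image_eq_zero_of_notMem_tsupport h2])
      exact hg (subset_closure ⟨h, h1, h⁻¹ * g, h2, by simp⟩)
    simp [this]

theorem conv_apply (f₁ f₂ : C_c(G, ℂ)) (g : G) :
    conv μ f₁ f₂ g = ∫ h, f₁ h * f₂ (h⁻¹ * g) ∂μ := rfl

theorem integrable_conv (f₁ f₂ : C_c(G, ℂ)) (g : G) :
    Integrable (fun h => f₁ h * f₂ (h⁻¹ * g)) μ := by
  have h1 := f₁.continuous
  have h2 := f₂.continuous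
  exact Continuous.integrable_of_hasCompactSupport (by fun_prop) f₁.hasCompactSupport.mul_right

theorem conv_add_left (f₁ f₁' f₂ : C_c(G, ℂ)) :
    conv μ (f₁ + f₁') f₂ = conv μ f₁ f₂ + conv μ f₁' f₂ := by
  ext g
  simp only [conv_apply, CompactlySupportedContinuousMap.add_apply, add_mul]
  exact integral_add (integrable_conv μ _ _ g) (integrable_conv μ _ _ g)

theorem conv_add_right (f₁ f₂ f₂' : C_c(G, ℂ)) :
    conv μ f₁ (f₂ + f₂') = conv μ f₁ f₂ + conv μ f₁ f₂' := by
  ext g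
  simp only [conv_apply, CompactlySupportedContinuousMap.add_apply, mul_add]
  exact integral_add (integrable_conv μ _ _ g) (integrable_conv μ _ _ g)

theorem conv_smul_left (c : ℂ) (f₁ f₂ : C_c(G, ℂ)) :
    conv μ (c • f₁) f₂ = c • conv μ f₁ f₂ := by
  ext g
  simp only [conv_apply, CompactlySupportedContinuousMap.smul_apply, smul_eq_mul, mul_assoc]
  exact integral_const_mul _ _

theorem conv_smul_right (c : ℂ) (f₁ f₂ : C_c(G, ℂ)) :
    conv μ f₁ (c • f₂) = c • conv μ f₁ f₂ := by
  ext g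
  simp only [conv_apply, CompactlySupportedContinuousMap.smul_apply, smul_eq_mul, mul_left_comm]
  exact integral_const_mul _ _

theorem op_conv (ρ : BanachRep.{u, v} G) (f₁ f₂ : C_c(G, ℂ)) :
    ρ.op μ (conv μ f₁ f₂) = (ρ.op μ f₁).comp (ρ.op μ f₂) := by
  ext x
  have hswap : ∫ h, (∫ g, (f₁ h * f₂ (h⁻¹ * g)) • ρ.π g x ∂μ) ∂μ
      = ∫ g, (∫ h, (f₁ h * f₂ (h⁻¹ * g)) • ρ.π g x ∂μ) ∂μ := by
    apply integral_integral_swap_of_hasCompactSupport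
    · have h1 := f₁.continuous
      have h2 := f₂.continuous
      have h3 := ρ.continuous_apply x
      exact Continuous.smul (by fun_prop) (h3.comp continuous_snd)
    · have hK : IsCompact (tsupport f₁ * tsupport f₂) :=
        f₁.hasCompactSupport.isCompact.mul f₂.hasCompactSupport.isCompact
      refine HasCompactSupport.intro' (f₁.hasCompactSupport.isCompact.prod hK.closure)
        ((isClosed_tsupport _).prod isClosed_closure) ?_
      rintro ⟨h, g⟩ hg
      by_cases h1 : h ∈ tsupport f₁
      · by_cases h2 : h⁻¹ * g ∈ tsupport f₂
        · exact absurd ⟨h1, subset_closure ⟨h, h1, h⁻¹ * g, h2, by simp⟩⟩ hg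
        · simp [image_eq_zero_of_notMem_tsupport h2]
      · simp [image_eq_zero_of_notMem_tsupport h1]
  have hL : ∀ h, f₁ h • ρ.π h (∫ g, f₂ g • ρ.π g x ∂μ)
      = ∫ g, (f₁ h * f₂ (h⁻¹ * g)) • ρ.π g x ∂μ := by
    intro h
    rw [← (ρ.π h).integral_comp_comm (ρ.integrable_smul μ f₂ x), ← integral_smul,
      ← integral_mul_left_eq_self (fun g => (f₁ h * f₂ (h⁻¹ * g)) • ρ.π g x) h]
    refine integral_congr_ae (Filter.Eventually.of_forall fun g => ?_)
    simp [mul_smul]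
  have hR : ∀ g, (∫ h, f₁ h * f₂ (h⁻¹ * g) ∂μ) • ρ.π g x
      = ∫ h, (f₁ h * f₂ (h⁻¹ * g)) • ρ.π g x ∂μ := fun g => (integral_smul_const _ _).symm
  simp only [ContinuousLinearMap.comp_apply, op_apply, conv_apply, hL, hR]
  exact hswap.symm

end Operators

/-- The family `F` is uniformly bounded on compact subsets of `G`. -/
def BddOnCompacts {G : Type u} [Group G] [TopologicalSpace G] (F : Set (BanachRep.{u, v} G)) :
    Prop :=
  ∀ K : Set G, IsCompact K → ∃ C : ℝ, ∀ ρ ∈ F, ∀ g ∈ K, ‖ρ.π g‖ ≤ C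

section Algebra

variable {G : Type u} [Group G] [TopologicalSpace G] [IsTopologicalGroup G]
  [MeasurableSpace G] [BorelSpace G] (μ : Measure G) [μ.IsHaarMeasure]

/-- `‖f‖_F = sup {‖π(f)‖ : (π, E) ∈ F}`. -/
def normF (F : Set (BanachRep.{u, v} G)) (f : C_c(G, ℂ)) : ℝ :=
  sSup {r | ∃ ρ ∈ F, r = ‖ρ.op μ f‖}

theorem bddAbove_normF {F : Set (BanachRep.{u, v} G)} (hF : BddOnCompacts F) (f : C_c(G, ℂ)) :
    BddAbove {r | ∃ ρ ∈ F, r = ‖ρ.op μ f‖} := by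
  obtain ⟨C, hC⟩ := hF _ f.hasCompactSupport
  refine ⟨(∫ g, ‖f g‖ ∂μ) * max C 0, ?_⟩
  rintro r ⟨ρ, hρ, rfl⟩
  exact ρ.norm_op_le μ f (le_max_right _ _) fun g hg => (hC ρ hρ g hg).trans (le_max_left _ _)

theorem norm_op_le_normF {F : Set (BanachRep.{u, v} G)} (hF : BddOnCompacts F)
    {ρ : BanachRep.{u, v} G} (hρ : ρ ∈ F) (f : C_c(G, ℂ)) : ‖ρ.op μ f‖ ≤ normF μ F f :=
  le_csSup (bddAbove_normF μ hF f) ⟨ρ, hρ, rfl⟩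

theorem normF_nonneg (F : Set (BanachRep.{u, v} G)) (f : C_c(G, ℂ)) : 0 ≤ normF μ F f := by
  apply Real.sSup_nonneg
  rintro r ⟨ρ, -, rfl⟩
  exact norm_nonneg _

theorem normF_le {F : Set (BanachRep.{u, v} G)} {f : C_c(G, ℂ)} {C : ℝ} (hC : 0 ≤ C)
    (h : ∀ ρ ∈ F, ‖ρ.op μ f‖ ≤ C) : normF μ F f ≤ C := by
  apply Real.sSup_le _ hC
  rintro r ⟨ρ, hρ, rfl⟩
  exact h ρ hρ

theorem normF_add_le {F : Set (BanachRep.{u, v} G)} (hF : BddOnCompacts F) (f₁ f₂ : C_c(G, ℂ)) :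
    normF μ F (f₁ + f₂) ≤ normF μ F f₁ + normF μ F f₂ := by
  refine normF_le μ (add_nonneg (normF_nonneg μ F _) (normF_nonneg μ F _)) fun ρ hρ => ?_
  rw [op_add]
  exact (norm_add_le _ _).trans
    (add_le_add (norm_op_le_normF μ hF hρ _) (norm_op_le_normF μ hF hρ _))

theorem normF_smul {F : Set (BanachRep.{u, v} G)} (hF : BddOnCompacts F) (c : ℂ)
    (f : C_c(G, ℂ)) : normF μ F (c • f) = ‖c‖ * normF μ F f := by
  have key : ∀ (c : ℂ) (f : C_c(G, ℂ)), normF μ F (c • f) ≤ ‖c‖ * normF μ F f := fun c f =>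
    normF_le μ (mul_nonneg (norm_nonneg _) (normF_nonneg μ F f)) fun ρ hρ => by
      rw [op_smul, norm_smul]
      exact mul_le_mul_of_nonneg_left (norm_op_le_normF μ hF hρ f) (norm_nonneg _)
  refine le_antisymm (key c f) ?_
  rcases eq_or_ne c 0 with rfl | hc
  · simpa using normF_nonneg μ F _
  · have h := key c⁻¹ (c • f)
    rw [smul_smul, inv_mul_cancel₀ hc, one_smul, norm_inv] at h
    rwa [← div_eq_inv_mul, le_div_iff₀' (norm_pos_iff.2 hc)] at h

theorem normF_conv_le {F : Set (BanachRep.{u, v} G)} (hF : BddOnCompacts F)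
    (f₁ f₂ : C_c(G, ℂ)) : normF μ F (conv μ f₁ f₂) ≤ normF μ F f₁ * normF μ F f₂ := by
  refine normF_le μ (mul_nonneg (normF_nonneg μ F _) (normF_nonneg μ F _)) fun ρ hρ => ?_
  rw [op_conv]
  exact (ContinuousLinearMap.opNorm_comp_le _ _).trans
    (mul_le_mul (norm_op_le_normF μ hF hρ _) (norm_op_le_normF μ hF hρ _) (norm_nonneg _)
      (normF_nonneg μ F _))

/-- The space `C_c(G)`, to be equipped with the seminorm `‖·‖_F`. -/
def CcF (F : Set (BanachRep.{u, v} G)) (_ : BddOnCompacts F) (_ : Measure G) : Type u := C_c(G, ℂ)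

variable {F : Set (BanachRep.{u, v} G)} {hF : BddOnCompacts F}

instance : AddCommGroup (CcF F hF μ) := inferInstanceAs (AddCommGroup C_c(G, ℂ))

instance : Module ℂ (CcF F hF μ) := inferInstanceAs (Module ℂ C_c(G, ℂ))

instance : Norm (CcF F hF μ) := ⟨normF μ F⟩

theorem ccF_core : SeminormedSpace.Core ℂ (CcF F hF μ) where
  norm_nonneg f := normF_nonneg μ F f
  norm_smul c f := normF_smul μ hF c f
  norm_triangle f₁ f₂ := normF_add_le μ hF f₁ f₂

instance : SeminormedAddCommGroup (CcF F hF μ) := SeminormedAddCommGroup.ofCore (ccF_core μ)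

instance : NormedSpace ℂ (CcF F hF μ) where
  norm_smul_le c f := ((ccF_core μ).norm_smul c f).le

variable (F hF)

/-- `C_F(G)`: the completion of `C_c(G)` for `‖·‖_F`. -/
abbrev CF : Type u := Completion (CcF F hF μ)

/-- The canonical map `C_c(G) → C_F(G)`. -/
def toCF (f : C_c(G, ℂ)) : CF μ F hF := ((show CcF F hF μ from f : CcF F hF μ) : CF μ F hF)

variable {F hF}

/-- The convolution product of `C_F(G)`: the continuous extension of convolution on `C_c(G)`. -/
instance : Mul (CF μ F hF) :=
  ⟨Function.curry <|
    ((Completion.isDenseInducing_coe (α := CcF F hF μ)).prodMap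
      (Completion.isDenseInducing_coe (α := CcF F hF μ))).extend
        fun p : CcF F hF μ × CcF F hF μ => toCF μ F hF (conv μ p.1 p.2)⟩

/-- Convolution on `(C_c(G), ‖·‖_F)` as a bounded bilinear map. -/
def convL : CcF F hF μ →L[ℂ] CcF F hF μ →L[ℂ] CcF F hF μ :=
  LinearMap.mkContinuous₂
    (LinearMap.mk₂ ℂ (M := C_c(G, ℂ)) (Nₗ := C_c(G, ℂ)) (Pₗ := C_c(G, ℂ)) (conv μ)
      (conv_add_left μ) (conv_smul_left μ) (conv_add_right μ) (conv_smul_right μ)) 1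
    (fun f₁ f₂ => by
      rw [one_mul]
      exact normF_conv_le μ hF f₁ f₂)

theorem continuous_convL :
    Continuous fun p : CcF F hF μ × CcF F hF μ => toCF μ F hF (conv μ p.1 p.2) :=
  (Completion.continuous_coe _).comp (convL (F := F) (hF := hF) μ).continuous₂

theorem toCF_mul (f₁ f₂ : C_c(G, ℂ)) :
    toCF μ F hF f₁ * toCF μ F hF f₂ = toCF μ F hF (conv μ f₁ f₂) :=
  ((Completion.isDenseInducing_coe (α := CcF F hF μ)).prodMap
      (Completion.isDenseInducing_coe (α := CcF F hF μ))).extend_eq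
    (continuous_convL μ) (f₁, f₂)

theorem continuous_mul_CF : Continuous fun p : CF μ F hF × CF μ F hF => p.1 * p.2 := by
  have di : IsDenseInducing (Completion.toCompl : CcF F hF μ → CF μ F hF) :=
    Completion.isDenseInducing_coe
  let φ : CcF F hF μ →+ CcF F hF μ →+ CF μ F hF :=
    AddMonoidHom.mk' (fun f₁ => (Completion.toCompl).comp (convL μ f₁).toLinearMap.toAddMonoidHom)
      (fun f₁ f₂ => by
        ext f
        simp [Completion.coe_add])
  have hφ : Continuous fun p : CcF F hF μ × CcF F hF μ => φ p.1 p.2 := continuous_convL μ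
  exact (di.extend_Z_bilin di hφ :)

/-- `f ↦ π(f)` on `(C_c(G), ‖·‖_F)`, for `(π, E) ∈ F`. -/
def opL {ρ : BanachRep.{u, v} G} (hρ : ρ ∈ F) : CcF F hF μ →L[ℂ] (ρ.E →L[ℂ] ρ.E) :=
  LinearMap.mkContinuous
    { toFun := fun f => ρ.op μ f
      map_add' := ρ.op_add μ
      map_smul' := ρ.op_smul μ } 1
    (fun f => (norm_op_le_normF μ hF hρ f).trans (one_mul _).ge)

/-- The extension of `π` to `C_F(G)`, for `(π, E) ∈ F`. -/
def ext {ρ : BanachRep.{u, v} G} (hρ : ρ ∈ F) : CF μ F hF →L[ℂ] (ρ.E →L[ℂ] ρ.E) :=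
  (opL (hF := hF) μ hρ).extend Completion.toComplL

theorem ext_toCF {ρ : BanachRep.{u, v} G} (hρ : ρ ∈ F) (f : C_c(G, ℂ)) :
    ext μ hρ (toCF μ F hF f) = ρ.op μ f :=
  (opL (hF := hF) μ hρ).extend_eq (e := Completion.toComplL) Completion.denseRange_coe
    (Completion.isUniformInducing_coe _) _

/-- Kazhdan projections in `C_F(G)`: idempotents in the closure of `{f ∈ C_c(G), ∫ f = 1}` acting
as a projection onto `E^π` for every `(π, E) ∈ F`. -/
structure IsKazhdanProjection (p : CF μ F hF) : Prop where
  idempotent : IsIdempotentElem p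
  mem_closure : p ∈ closure (toCF μ F hF '' {f | ∫ g, f g ∂μ = 1})
  isProj : ∀ (ρ : BanachRep.{u, v} G) (hρ : ρ ∈ F), LinearMap.IsProj ρ.invariants (ext μ hρ p)

variable (F) in
/-- `C_F(G)` is defined, i.e. `F` is uniformly bounded on compact sets, and it has a Kazhdan
projection. -/
def HasKazhdanProjection : Prop :=
  ∃ (hF : BddOnCompacts F) (p : CF μ F hF), IsKazhdanProjection μ p

end Algebra

section RepSpace

variable {G : Type u} [Group G] [TopologicalSpace G]

/-- Representations on separable Banach spaces with `‖π(g)‖ ≤ M` for all `g ∈ S`. -/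
def Rep (S : Set G) (M : ℝ) : Type (max u (v + 1)) :=
  {ρ : BanachRep.{u, v} G // TopologicalSpace.SeparableSpace ρ.E ∧ ∀ g ∈ S, ‖ρ.π g‖ ≤ M}

/-- Equivalence of representations. -/
instance repSetoid (S : Set G) (M : ℝ) : Setoid (Rep.{u, v} S M) where
  r ρ₁ ρ₂ := Equivalent ρ₁.1 ρ₂.1
  iseqv :=
    { refl := fun ρ => ⟨LinearIsometryEquiv.refl ℂ _, fun _ _ => rfl⟩
      symm := by
        rintro ρ₁ ρ₂ ⟨T, hT⟩
        refine ⟨T.symm, fun g x => ?_⟩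
        rw [LinearIsometryEquiv.symm_apply_eq, hT, LinearIsometryEquiv.apply_symm_apply]
      trans := by
        rintro ρ₁ ρ₂ ρ₃ ⟨T, hT⟩ ⟨T', hT'⟩
        refine ⟨T.trans T', fun g x => ?_⟩
        simp only [LinearIsometryEquiv.trans_apply, hT, hT'] }

/-- The space `R` of equivalence classes of representations of `G` on separable Banach spaces with
`‖π(g)‖ ≤ M` for all `g ∈ S`. -/
def RepSpace (S : Set G) (M : ℝ) : Type (max u (v + 1)) := Quotient (repSetoid.{u, v} S M)

/-- The equivalence class of a representation. -/
def Rep.cls {S : Set G} {M : ℝ} (ρ : Rep.{u, v} S M) : RepSpace.{u, v} S M :=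
  Quotient.mk (repSetoid.{u, v} S M) ρ

/-- All the representations whose class belongs to `F`. -/
def RepSpace.reps {S : Set G} {M : ℝ} (F : Set (RepSpace.{u, v} S M)) :
    Set (BanachRep.{u, v} G) :=
  {ρ | ∃ ρ' : Rep.{u, v} S M, ρ'.1 = ρ ∧ ρ'.cls ∈ F}

variable [IsTopologicalGroup G] [MeasurableSpace G] [BorelSpace G]
  (μ : Measure G) [μ.IsHaarMeasure]

/-- `IsClose μ ρ x Q ε ρ'` : for suitable vectors `x'₁, …, x'ₙ` of `ρ'`, the supremum of
`|‖∑ π'(f_k) x'_k‖ - ‖∑ π(f_k) x_k‖|` over all `f₁, …, fₙ ∈ C_c(G)` supported in `Q` with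
`‖f_k‖_{L₁} ≤ 1` is `< ε`. -/
def IsClose (ρ : BanachRep.{u, v} G) {n : ℕ} (x : Fin n → ρ.E) (Q : Set G) (ε : ℝ)
    (ρ' : BanachRep.{u, v} G) : Prop :=
  ∃ x' : Fin n → ρ'.E, ∃ δ < ε, ∀ f : Fin n → C_c(G, ℂ),
    (∀ k, tsupport (f k) ⊆ Q ∧ ∫ g, ‖f k g‖ ∂μ ≤ 1) →
      |‖∑ k, ρ'.op μ (f k) (x' k)‖ - ‖∑ k, ρ.op μ (f k) (x k)‖| ≤ δ

/-- The basic open set `W_{x₁,…,xₙ,Q,ε}(π, E)` of `R`. -/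
def W {S : Set G} {M : ℝ} (ρ : Rep.{u, v} S M) {n : ℕ} (x : Fin n → ρ.1.E) (Q : Set G) (ε : ℝ) :
    Set (RepSpace.{u, v} S M) :=
  {c | ∃ ρ' : Rep.{u, v} S M, ρ'.cls = c ∧ IsClose μ ρ.1 x Q ε ρ'.1}

/-- The Fell-like topology on `R`, with basis the sets `W_{x₁,…,xₙ,Q,ε}(π, E)`. -/
@[reducible] def fellTopology (S : Set G) (M : ℝ) : TopologicalSpace (RepSpace.{u, v} S M) :=
  TopologicalSpace.generateFrom
    {V | ∃ (ρ : Rep.{u, v} S M) (n : ℕ) (x : Fin n → ρ.1.E) (Q : Set G) (ε : ℝ),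
      IsCompact Q ∧ 0 < ε ∧ V = W μ ρ x Q ε}

end RepSpace

end BanachRep

/-- `B` is a strong neighbourhood of `A`: `B` belongs to every ultrafilter all of whose accumulation
points are in `A`. -/
def IsStrongNhd {X : Type*} (t : TopologicalSpace X) (B A : Set X) : Prop :=
  ∀ 𝒰 : Ultrafilter X, (∀ x, @ClusterPt X t x (𝒰 : Filter X) → x ∈ A) → B ∈ 𝒰

end

/-! A Kazhdan projection together with the vanishing of `H¹` on `F` provides, for every `κ > 0`, an
`m ∈ C_c(G)` with `∫ m = 1` whose averaging operators `x ↦ ∫ m(g) σ(g) x dg` multiply the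
displacement `sup_{s ∈ S} ‖σ(s) x - x‖` by at most `κ`, for all affine actions `σ` with linear part
in `F`. Conversely, if such an `m` exists for some `κ < 1`, iterating the averaging operator leads
to a fixed point, and the convolution powers of `m` converge to a Kazhdan projection.

The contraction passes to a strong neighbourhood. Fix `f ∈ C_c(G)` with `∫ f = 1` and suppose that
`m * f` fails to contract on a set of an ultrafilter `𝒰` whose accumulation points are all in `F`.
Choose a cocycle witnessing each failure, normalized to displacement at most `1`, and move its base
point to the barycenter given by `f`: this smoothing makes the cocycles equicontinuous. Their
ultralimit along `𝒰` is a cocycle that generates a separable representation, which is an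
accumulation point of `𝒰` and hence lies in `F`. There `m` contracts, a contradiction. -/

/-! ### Compact generating sets -/

/-- `S` is a compact symmetric generating set of `G` containing the identity. -/
structure IsCompactGenerating {G : Type u} [Group G] [TopologicalSpace G] (S : Set G) : Prop where
  isCompact : IsCompact S
  inv_eq : S⁻¹ = S
  one_mem : (1 : G) ∈ S
  closure_eq_top : Subgroup.closure S = ⊤

namespace IsCompactGenerating

variable {G : Type u} [Group G] [TopologicalSpace G] {S : Set G}

theorem exists_mem_pow (hS : IsCompactGenerating S) (g : G) : ∃ n : ℕ, g ∈ S ^ n := by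
  have hg : g ∈ Subgroup.closure S := hS.closure_eq_top ▸ Subgroup.mem_top g
  induction hg using Subgroup.closure_induction with
  | mem s hs => exact ⟨1, by rwa [pow_one]⟩
  | one => exact ⟨0, by rw [pow_zero]; exact Set.one_mem_one⟩
  | mul g h _ _ hg hh =>
    obtain ⟨a, ha⟩ := hg
    obtain ⟨b, hb⟩ := hh
    exact ⟨a + b, by rw [pow_add]; exact Set.mul_mem_mul ha hb⟩
  | inv g _ hg =>
    obtain ⟨a, ha⟩ := hg
    exact ⟨a, by rwa [← hS.inv_eq, inv_pow, Set.inv_mem_inv]⟩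

variable [IsTopologicalGroup G]

theorem isCompact_pow (hS : IsCompactGenerating S) (n : ℕ) : IsCompact (S ^ n) := by
  induction n with
  | zero => rw [pow_zero]; exact isCompact_singleton
  | succ n ih => rw [pow_succ]; exact ih.mul hS.isCompact

variable [T2Space G] [BaireSpace G]

theorem exists_mem_interior_pow (hS : IsCompactGenerating S) (g : G) :
    ∃ n : ℕ, g ∈ interior (S ^ n) := by
  obtain ⟨n, x, hx⟩ := nonempty_interior_of_iUnion_of_closed
    (fun n => (hS.isCompact_pow n).isClosed) (Set.iUnion_eq_univ_iff.2 hS.exists_mem_pow)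
  obtain ⟨k, hk⟩ := hS.exists_mem_pow (g * x⁻¹)
  refine ⟨k + n, ?_⟩
  rw [pow_add]
  exact subset_interior_mul_right ⟨g * x⁻¹, hk, x, hx, inv_mul_cancel_right g x⟩

theorem exists_subset_pow (hS : IsCompactGenerating S) {K : Set G} (hK : IsCompact K) :
    ∃ n : ℕ, K ⊆ S ^ n := by
  obtain ⟨n, hn⟩ := hK.elim_directed_cover (fun n => interior (S ^ n)) (fun _ => isOpen_interior)
    (fun g _ => Set.mem_iUnion.2 (hS.exists_mem_interior_pow g))
    (Monotone.directed_le fun _ _ hab => interior_mono (Set.pow_subset_pow_right hS.one_mem hab))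
  exact ⟨n, hn.trans interior_subset⟩

end IsCompactGenerating

namespace BanachRep

/-! ### Cocycles -/

section Cocycles

variable {G : Type u} [Group G] [TopologicalSpace G] (ρ : BanachRep.{u, v} G)

/-- The coboundary `g ↦ x - π(g) x`, which is the cocycle of the affine action with linear part `π`
fixing `x`. -/
def coboundary (x : ρ.E) : G → ρ.E := fun g => x - ρ.π g x

/-- The cocycle of the affine action `σ(g) x = π(g) x + b(g)` after moving the origin to `w`, i.e.
the displacement `g ↦ σ(g) w - w`. -/
def rebase (b : G → ρ.E) (w : ρ.E) : G → ρ.E := fun g => b g + ρ.π g w - w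

theorem rebase_eq_sub_coboundary (b : G → ρ.E) (w : ρ.E) :
    ρ.rebase b w = b - ρ.coboundary w := by
  ext g
  simp only [rebase, coboundary, Pi.sub_apply]
  abel

theorem rebase_zero (b : G → ρ.E) : ρ.rebase b 0 = b := by
  ext g
  simp [rebase]

theorem rebase_rebase (b : G → ρ.E) (w w' : ρ.E) :
    ρ.rebase (ρ.rebase b w) w' = ρ.rebase b (w + w') := by
  ext g
  simp only [rebase, map_add]
  abel

theorem rebase_smul (c : ℂ) (b : G → ρ.E) (w : ρ.E) :
    ρ.rebase (c • b) (c • w) = c • ρ.rebase b w := by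
  ext g
  simp only [rebase, Pi.smul_apply, map_smul, smul_add, smul_sub]

theorem rebase_coboundary (x w : ρ.E) :
    ρ.rebase (ρ.coboundary x) w = ρ.coboundary (x - w) := by
  ext g
  simp only [rebase, coboundary, map_sub]
  abel

theorem coboundary_mem_Z1 (x : ρ.E) : ρ.coboundary x ∈ ρ.Z1 := by
  refine ⟨continuous_const.sub (ρ.continuous_apply x), fun g h => ?_⟩
  simp only [coboundary, map_mul, map_sub, mul_apply_eq_comp]
  abel

variable {ρ}

theorem rebase_mem_Z1 {b : G → ρ.E} (hb : b ∈ ρ.Z1) (w : ρ.E) : ρ.rebase b w ∈ ρ.Z1 := by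
  rw [rebase_eq_sub_coboundary]
  exact ρ.Z1.sub_mem hb (ρ.coboundary_mem_Z1 w)

theorem cocycle_one {b : G → ρ.E} (hb : b ∈ ρ.Z1) : b 1 = 0 := by
  have h := hb.2 1 1
  rw [mul_one, map_one] at h
  simpa using h

theorem cocycle_eq_zero_of_closure_eq_top {S : Set G} (hS : Subgroup.closure S = ⊤) {b : G → ρ.E}
    (hb : b ∈ ρ.Z1) (h : ∀ s ∈ S, b s = 0) : b = 0 := by
  ext g
  have hg : g ∈ Subgroup.closure S := hS ▸ Subgroup.mem_top g
  induction hg using Subgroup.closure_induction with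
  | mem s hs => exact h s hs
  | one => exact cocycle_one hb
  | mul g k _ _ hg hk => simp [hb.2, hg, hk]
  | inv g _ hg =>
    have hinv := hb.2 g⁻¹ g
    rw [inv_mul_cancel, cocycle_one hb, hg] at hinv
    simpa using hinv.symm

theorem eq_coboundary_of_tendsto_rebase {S : Set G} (hS : Subgroup.closure S = ⊤) {b : G → ρ.E}
    (hb : b ∈ ρ.Z1) {w : ℕ → ρ.E} {x : ρ.E} (hw : Filter.Tendsto w Filter.atTop (𝓝 x))
    (h : ∀ s ∈ S, Filter.Tendsto (fun n => ρ.rebase b (w n) s) Filter.atTop (𝓝 0)) :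
    b = ρ.coboundary x := by
  rw [← sub_eq_zero, ← rebase_eq_sub_coboundary]
  refine cocycle_eq_zero_of_closure_eq_top hS (rebase_mem_Z1 hb x) fun s hs => ?_
  have hlim : Filter.Tendsto (fun n => ρ.rebase b (w n) s) Filter.atTop (𝓝 (ρ.rebase b x s)) :=
    (tendsto_const_nhds.add (((ρ.π s).continuous.tendsto x).comp hw)).sub hw
  exact tendsto_nhds_unique hlim (h s hs)

theorem subsingleton_H1_iff : Subsingleton ρ.H1 ↔ ∀ b ∈ ρ.Z1, ∃ x, b = ρ.coboundary x := by
  rw [Submodule.Quotient.subsingleton_iff, Submodule.eq_top_iff']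
  simp only [funext_iff]
  exact ⟨fun h b hb => h ⟨b, hb⟩, fun h b => h b.1 b.2⟩

theorem coboundary_eq_zero_iff {x : ρ.E} : ρ.coboundary x = 0 ↔ x ∈ ρ.invariants := by
  simp only [funext_iff, coboundary, Pi.zero_apply, sub_eq_zero]
  exact forall_congr' fun g => eq_comm

theorem norm_coboundary_le {g : G} {M : ℝ} (hg : ‖ρ.π g‖ ≤ M) (x : ρ.E) :
    ‖ρ.coboundary x g‖ ≤ (1 + M) * ‖x‖ := by
  rw [add_mul, one_mul]
  exact norm_sub_le_of_le le_rfl ((ρ.π g).le_of_opNorm_le hg x)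

theorem norm_le_pow_of_mem_pow {S : Set G} {M : ℝ} (hρ : ∀ s ∈ S, ‖ρ.π s‖ ≤ M) {n : ℕ} {g : G}
    (hg : g ∈ S ^ n) : ‖ρ.π g‖ ≤ M ^ n := by
  induction n generalizing g with
  | zero =>
    rw [pow_zero, Set.mem_one] at hg
    rw [hg, map_one, pow_zero]
    exact ContinuousLinearMap.norm_id_le
  | succ n ih =>
    obtain ⟨a, ha, s, hs, rfl⟩ := pow_succ S n ▸ hg
    rw [pow_succ]
    simp only [map_mul]
    exact norm_mul_le_of_le (ih ha) (hρ s hs)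

theorem norm_cocycle_le_of_mem_pow {S : Set G} {M : ℝ} (hρ : ∀ s ∈ S, ‖ρ.π s‖ ≤ M) {b : G → ρ.E}
    (hb : b ∈ ρ.Z1) {D : ℝ} (hD : ∀ s ∈ S, ‖b s‖ ≤ D) {n : ℕ} {g : G} (hg : g ∈ S ^ n) :
    ‖b g‖ ≤ (∑ i ∈ Finset.range n, M ^ i) * D := by
  induction n generalizing g with
  | zero =>
    rw [pow_zero, Set.mem_one] at hg
    simp [hg, cocycle_one hb]
  | succ n ih =>
    obtain ⟨a, ha, s, hs, rfl⟩ := pow_succ S n ▸ hg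
    rw [Finset.sum_range_succ, add_mul]
    simp only [hb.2]
    exact norm_add_le_of_le (ih ha)
      ((ρ.π a).le_of_opNorm_le_of_le (norm_le_pow_of_mem_pow hρ ha) (hD s hs))

end Cocycles

section UniformBounds

variable {G : Type u} [Group G] [TopologicalSpace G] [IsTopologicalGroup G] [T2Space G]
  [BaireSpace G] {S : Set G}

theorem bddOnCompacts_of_forall_norm_le (hS : IsCompactGenerating S) {M : ℝ}
    {F : Set (BanachRep.{u, v} G)} (hF : ∀ ρ ∈ F, ∀ s ∈ S, ‖ρ.π s‖ ≤ M) : BddOnCompacts F := by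
  intro K hK
  obtain ⟨n, hn⟩ := hS.exists_subset_pow hK
  exact ⟨M ^ n, fun ρ hρ g hg => norm_le_pow_of_mem_pow (hF ρ hρ) (hn hg)⟩

theorem exists_norm_cocycle_le (hS : IsCompactGenerating S) (M : ℝ) {K : Set G}
    (hK : IsCompact K) :
    ∃ C : ℝ, 0 ≤ C ∧ ∀ ρ : BanachRep.{u, v} G, (∀ s ∈ S, ‖ρ.π s‖ ≤ M) → ∀ b ∈ ρ.Z1, ∀ D : ℝ,
      (∀ s ∈ S, ‖b s‖ ≤ D) → ∀ g ∈ K, ‖b g‖ ≤ C * D := by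
  obtain ⟨n, hn⟩ := hS.exists_subset_pow hK
  refine ⟨|∑ i ∈ Finset.range n, M ^ i|, abs_nonneg _, fun ρ hρ b hb D hD g hg => ?_⟩
  have hD0 : 0 ≤ D := (norm_nonneg _).trans (hD 1 hS.one_mem)
  exact (norm_cocycle_le_of_mem_pow hρ hb hD (hn hg)).trans
    (mul_le_mul_of_nonneg_right (le_abs_self _) hD0)

end UniformBounds

/-! ### Averaging -/

section Barycenter

variable {G : Type u} [TopologicalSpace G] [MeasurableSpace G] (μ : Measure G)
  {E : Type v} [NormedAddCommGroup E] [NormedSpace ℂ E]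

/-- The average `∫ m(g) b(g) dg`. If `b` is the cocycle of an affine action `σ` and `∫ m = 1`, then
it is `σ(m) 0`. -/
noncomputable def barycenter (m : C_c(G, ℂ)) (b : G → E) : E := ∫ g, m g • b g ∂μ

theorem barycenter_smul (m : C_c(G, ℂ)) (c : ℂ) (b : G → E) :
    barycenter μ m (c • b) = c • barycenter μ m b := by
  simp only [barycenter, Pi.smul_apply, smul_comm _ c, integral_smul]

theorem barycenter_const [CompleteSpace E] {m : C_c(G, ℂ)} (hm : ∫ g, m g ∂μ = 1) (x : E) :
    barycenter μ m (fun _ => x) = x := by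
  rw [barycenter, integral_smul_const, hm, one_smul]

variable [BorelSpace G] [IsFiniteMeasureOnCompacts μ] (m : C_c(G, ℂ))

theorem integrable_cc : Integrable m μ :=
  m.continuous.integrable_of_hasCompactSupport m.hasCompactSupport

theorem integrable_cc_smul {b : G → E} (hb : Continuous b) : Integrable (fun g => m g • b g) μ :=
  (m.continuous.smul hb).integrable_of_hasCompactSupport m.hasCompactSupport.smul_right

variable {m}

theorem barycenter_add {b b' : G → E} (hb : Continuous b) (hb' : Continuous b') :
    barycenter μ m (b + b') = barycenter μ m b + barycenter μ m b' := by
  simp only [barycenter, Pi.add_apply, smul_add]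
  exact integral_add (integrable_cc_smul μ m hb) (integrable_cc_smul μ m hb')

theorem barycenter_sub {b b' : G → E} (hb : Continuous b) (hb' : Continuous b') :
    barycenter μ m (b - b') = barycenter μ m b - barycenter μ m b' := by
  simp only [barycenter, Pi.sub_apply, smul_sub]
  exact integral_sub (integrable_cc_smul μ m hb) (integrable_cc_smul μ m hb')

theorem map_barycenter [CompleteSpace E] {E' : Type*} [NormedAddCommGroup E'] [NormedSpace ℂ E']
    [CompleteSpace E'] (T : E →L[ℂ] E') {b : G → E} (hb : Continuous b) :
    T (barycenter μ m b) = barycenter μ m (fun g => T (b g)) := by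
  rw [barycenter, ← T.integral_comp_comm (integrable_cc_smul μ m hb)]
  simp only [map_smul, barycenter]

theorem norm_barycenter_le {b : G → E} {C : ℝ} (hC : ∀ g ∈ tsupport m, ‖b g‖ ≤ C) :
    ‖barycenter μ m b‖ ≤ (∫ g, ‖m g‖ ∂μ) * C := by
  rw [← integral_mul_const]
  refine norm_integral_le_of_norm_le ((integrable_cc μ m).norm.mul_const _) (.of_forall fun g => ?_)
  rw [norm_smul]
  by_cases hg : g ∈ tsupport m
  · exact mul_le_mul_of_nonneg_left (hC g hg) (norm_nonneg _)
  · simp [image_eq_zero_of_notMem_tsupport hg]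

end Barycenter

theorem barycenter_mul_left {G : Type u} [Group G] [TopologicalSpace G] [MeasurableSpace G]
    [BorelSpace G] {μ : Measure G} [IsFiniteMeasureOnCompacts μ] {ρ : BanachRep.{u, v} G}
    {b : G → ρ.E} (hb : b ∈ ρ.Z1) {f : C_c(G, ℂ)} (hf : ∫ g, f g ∂μ = 1) (h : G) :
    barycenter μ f (fun g => b (h * g)) = b h + ρ.π h (barycenter μ f b) := by
  have hcont : Continuous fun g => ρ.π h (b g) := (ρ.π h).continuous.comp hb.1
  have hsplit : (fun g => b (h * g)) = (fun _ => b h) + fun g => ρ.π h (b g) :=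
    funext fun g => hb.2 h g
  rw [hsplit, barycenter_add μ continuous_const hcont, barycenter_const μ hf,
    map_barycenter μ _ hb.1]

section Convolution

theorem hasCompactSupport_mul_translate_smul {G : Type u} [Group G] [TopologicalSpace G]
    [IsTopologicalGroup G] {E : Type v} [NormedAddCommGroup E] [NormedSpace ℂ E] (f₁ f₂ : C_c(G, ℂ))
    (b : G → E) :
    HasCompactSupport fun p : G × G => (f₁ p.1 * f₂ (p.1⁻¹ * p.2)) • b p.2 := by
  have hK : IsCompact (tsupport f₁ * tsupport f₂) :=
    f₁.hasCompactSupport.isCompact.mul f₂.hasCompactSupport.isCompact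
  refine HasCompactSupport.intro' (f₁.hasCompactSupport.isCompact.prod hK.closure)
    ((isClosed_tsupport _).prod isClosed_closure) ?_
  rintro ⟨h, g⟩ hg
  by_cases h₁ : h ∈ tsupport f₁
  · by_cases h₂ : h⁻¹ * g ∈ tsupport f₂
    · exact absurd ⟨h₁, subset_closure ⟨h, h₁, h⁻¹ * g, h₂, mul_inv_cancel_left h g⟩⟩ hg
    · simp [image_eq_zero_of_notMem_tsupport h₂]
  · simp [image_eq_zero_of_notMem_tsupport h₁]

variable {G : Type u} [Group G] [TopologicalSpace G] [IsTopologicalGroup G]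
  [MeasurableSpace G] [BorelSpace G] (μ : Measure G) [μ.IsHaarMeasure]

theorem barycenter_conv {E : Type v} [NormedAddCommGroup E] [NormedSpace ℂ E] [CompleteSpace E]
    (f₁ f₂ : C_c(G, ℂ)) {b : G → E} (hb : Continuous b) :
    barycenter μ (conv μ f₁ f₂) b
      = barycenter μ f₁ fun h => barycenter μ f₂ fun g => b (h * g) := by
  have hcont : Continuous fun p : G × G => (f₁ p.1 * f₂ (p.1⁻¹ * p.2)) • b p.2 :=
    ((f₁.continuous.comp continuous_fst).mul (f₂.continuous.comp (by fun_prop))).smul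
      (hb.comp continuous_snd)
  have hinner : ∀ h, f₁ h • barycenter μ f₂ (fun g => b (h * g))
      = ∫ g, (f₁ h * f₂ (h⁻¹ * g)) • b g ∂μ := by
    intro h
    rw [← integral_mul_left_eq_self (fun g => (f₁ h * f₂ (h⁻¹ * g)) • b g) h]
    simp only [inv_mul_cancel_left, mul_smul, integral_smul, barycenter]
  calc barycenter μ (conv μ f₁ f₂) b
      = ∫ g, ∫ h, (f₁ h * f₂ (h⁻¹ * g)) • b g ∂μ ∂μ := by
        simp only [barycenter, conv_apply, integral_smul_const]
    _ = ∫ h, ∫ g, (f₁ h * f₂ (h⁻¹ * g)) • b g ∂μ ∂μ :=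
        (integral_integral_swap_of_hasCompactSupport hcont
          (hasCompactSupport_mul_translate_smul f₁ f₂ b)).symm
    _ = barycenter μ f₁ fun h => barycenter μ f₂ fun g => b (h * g) := by
        simp only [← hinner, barycenter]

theorem integral_conv (f₁ f₂ : C_c(G, ℂ)) :
    ∫ g, conv μ f₁ f₂ g ∂μ = (∫ g, f₁ g ∂μ) * ∫ g, f₂ g ∂μ := by
  simpa [barycenter, integral_mul_const] using
    barycenter_conv μ f₁ f₂ (b := fun _ => (1 : ℂ)) continuous_const

variable {μ} {ρ : BanachRep.{u, v} G} {b : G → ρ.E}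

/-- This is `σ(f₁ * f₂) 0 = σ(f₁) (σ(f₂) 0)` for an affine action `σ`. -/
theorem barycenter_conv_cocycle (hb : b ∈ ρ.Z1) {f₁ f₂ : C_c(G, ℂ)} (hf₁ : ∫ g, f₁ g ∂μ = 1)
    (hf₂ : ∫ g, f₂ g ∂μ = 1) :
    barycenter μ (conv μ f₁ f₂) b
      = barycenter μ f₂ b + barycenter μ f₁ (ρ.rebase b (barycenter μ f₂ b)) := by
  set w := barycenter μ f₂ b with hw
  have hcont : Continuous fun h => b h + ρ.π h w := hb.1.add (ρ.continuous_apply w)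
  have hrebase : ρ.rebase b w = (fun h => b h + ρ.π h w) - fun _ => w := rfl
  rw [hrebase, barycenter_sub μ hcont continuous_const, barycenter_const μ hf₁, add_sub_cancel,
    barycenter_conv μ f₁ f₂ hb.1]
  simp only [barycenter_mul_left hb hf₂, hw]

end Convolution

/-! ### Contraction of the displacement -/

section Contracts

variable {G : Type u} [Group G] [TopologicalSpace G] [MeasurableSpace G] (μ : Measure G)

/-- For every affine action `σ` with linear part `ρ`, the operator `σ(m)` contracts the displacement
`x ↦ sup {‖σ(s) x - x‖ : s ∈ S}` by the factor `κ`. Moving the origin and rescaling, it is enough to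
require this at `x = 0` when the displacement there, `sup {‖b s‖ : s ∈ S}`, is at most `1`. -/
def Contracts (S : Set G) (m : C_c(G, ℂ)) (κ : ℝ) (ρ : BanachRep.{u, v} G) : Prop :=
  ∀ b ∈ ρ.Z1, (∀ s ∈ S, ‖b s‖ ≤ 1) → ∀ s ∈ S, ‖ρ.rebase b (barycenter μ m b) s‖ ≤ κ

/-- The orbit of the origin under `σ(m)`, for the affine action `σ` with cocycle `b`. -/
noncomputable def averagingOrbit (ρ : BanachRep.{u, v} G) (m : C_c(G, ℂ)) (b : G → ρ.E) (n : ℕ) :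
    ρ.E :=
  (fun w => w + barycenter μ m (ρ.rebase b w))^[n] 0

variable {μ} {ρ : BanachRep.{u, v} G} {m : C_c(G, ℂ)} {b : G → ρ.E}

theorem averagingOrbit_succ (n : ℕ) :
    averagingOrbit μ ρ m b (n + 1) = averagingOrbit μ ρ m b n
      + barycenter μ m (ρ.rebase b (averagingOrbit μ ρ m b n)) :=
  Function.iterate_succ_apply' _ n 0

variable {S : Set G} {κ : ℝ}

theorem Contracts.norm_rebase_barycenter_le (h : Contracts μ S m κ ρ) (hb : b ∈ ρ.Z1) {D : ℝ}
    (hD : ∀ s ∈ S, ‖b s‖ ≤ D) {s : G} (hs : s ∈ S) :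
    ‖ρ.rebase b (barycenter μ m b) s‖ ≤ κ * D := by
  have hbound : ∀ D' ∈ Set.Ioi D, ‖ρ.rebase b (barycenter μ m b) s‖ ≤ κ * D' := by
    intro D' hD'
    have hpos : 0 < D' := ((norm_nonneg _).trans (hD s hs)).trans_lt hD'
    have hnorm : ‖(D' : ℂ)⁻¹‖ = D'⁻¹ := by
      rw [norm_inv, Complex.norm_real, Real.norm_of_nonneg hpos.le]
    have hscaled := h ((D' : ℂ)⁻¹ • b) (ρ.Z1.smul_mem _ hb) (fun t ht => by
      rw [Pi.smul_apply, norm_smul, hnorm, inv_mul_le_iff₀ hpos, mul_one]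
      exact (hD t ht).trans (le_of_lt hD')) s hs
    rwa [barycenter_smul, rebase_smul, Pi.smul_apply, norm_smul, hnorm, inv_mul_le_iff₀ hpos,
      mul_comm] at hscaled
  exact ge_of_tendsto (((continuous_const_mul κ).tendsto D).mono_left nhdsWithin_le_nhds)
    (Filter.mem_of_superset self_mem_nhdsWithin hbound)

theorem Contracts.norm_rebase_averagingOrbit_le (h : Contracts μ S m κ ρ) (hb : b ∈ ρ.Z1) {D : ℝ}
    (hD : ∀ s ∈ S, ‖b s‖ ≤ D) (n : ℕ) {s : G} (hs : s ∈ S) :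
    ‖ρ.rebase b (averagingOrbit μ ρ m b n) s‖ ≤ κ ^ n * D := by
  induction n generalizing s with
  | zero =>
    rw [pow_zero, one_mul]
    exact (congrFun (ρ.rebase_zero b) s).symm ▸ hD s hs
  | succ n ih =>
    rw [averagingOrbit_succ, ← rebase_rebase, pow_succ', mul_assoc]
    exact h.norm_rebase_barycenter_le (rebase_mem_Z1 hb _) (fun t ht => ih ht) hs

theorem Contracts.tendsto_rebase_averagingOrbit (h : Contracts μ S m κ ρ) (hκ0 : 0 ≤ κ)
    (hκ : κ < 1) (hb : b ∈ ρ.Z1) {D : ℝ} (hD : ∀ s ∈ S, ‖b s‖ ≤ D) {s : G} (hs : s ∈ S) :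
    Filter.Tendsto (fun n => ρ.rebase b (averagingOrbit μ ρ m b n) s) Filter.atTop (𝓝 0) := by
  refine squeeze_zero_norm (fun n => h.norm_rebase_averagingOrbit_le hb hD n hs) ?_
  simpa using (tendsto_pow_atTop_nhds_zero_of_lt_one hκ0 hκ).mul_const D

theorem Contracts.norm_averagingOrbit_sub_le (h : Contracts μ S m κ ρ) {C : ℝ}
    (hC : ∀ b ∈ ρ.Z1, ∀ D : ℝ, (∀ s ∈ S, ‖b s‖ ≤ D) → ‖barycenter μ m b‖ ≤ C * D)
    (hb : b ∈ ρ.Z1) {D : ℝ} (hD : ∀ s ∈ S, ‖b s‖ ≤ D) (n : ℕ) :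
    ‖averagingOrbit μ ρ m b n - averagingOrbit μ ρ m b (n + 1)‖ ≤ C * D * κ ^ n := by
  rw [averagingOrbit_succ, norm_sub_rev, add_sub_cancel_left, mul_assoc, mul_comm D]
  exact hC _ (rebase_mem_Z1 hb _) _ fun s hs => h.norm_rebase_averagingOrbit_le hb hD n hs

theorem Contracts.subsingleton_H1 (hS : IsCompact S) (hS_gen : Subgroup.closure S = ⊤)
    (h : Contracts μ S m κ ρ) (hκ0 : 0 ≤ κ) (hκ : κ < 1) {C : ℝ}
    (hC : ∀ b ∈ ρ.Z1, ∀ D : ℝ, (∀ s ∈ S, ‖b s‖ ≤ D) → ‖barycenter μ m b‖ ≤ C * D) :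
    Subsingleton ρ.H1 := by
  refine subsingleton_H1_iff.2 fun b hb => ?_
  obtain ⟨D, hD⟩ := hS.exists_bound_of_continuousOn hb.1.continuousOn
  obtain ⟨x, hx⟩ := cauchySeq_tendsto_of_complete (cauchySeq_of_le_geometric κ (C * D) hκ fun n =>
    (dist_eq_norm _ _).trans_le (h.norm_averagingOrbit_sub_le hC hb hD n))
  exact ⟨x, eq_coboundary_of_tendsto_rebase hS_gen hb hx fun s hs =>
    h.tendsto_rebase_averagingOrbit hκ0 hκ hb hD hs⟩

end Contracts

theorem exists_norm_barycenter_le {G : Type u} [Group G] [TopologicalSpace G]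
    [IsTopologicalGroup G] [T2Space G] [BaireSpace G] [MeasurableSpace G] [BorelSpace G]
    (μ : Measure G) [IsFiniteMeasureOnCompacts μ] {S : Set G} (hS : IsCompactGenerating S) (M : ℝ)
    (m : C_c(G, ℂ)) :
    ∃ C : ℝ, 0 ≤ C ∧ ∀ ρ : BanachRep.{u, v} G, (∀ s ∈ S, ‖ρ.π s‖ ≤ M) → ∀ b ∈ ρ.Z1, ∀ D : ℝ,
      (∀ s ∈ S, ‖b s‖ ≤ D) → ‖barycenter μ m b‖ ≤ C * D := by
  obtain ⟨C, hC0, hC⟩ := exists_norm_cocycle_le.{u, v} hS M m.hasCompactSupport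
  refine ⟨(∫ g, ‖m g‖ ∂μ) * C, mul_nonneg (integral_nonneg fun _ => norm_nonneg _) hC0,
    fun ρ hρ b hb D hD => ?_⟩
  rw [mul_assoc]
  exact norm_barycenter_le μ (hC ρ hρ b hb D hD)

section Operators

variable {G : Type u} [Group G] [TopologicalSpace G] [IsTopologicalGroup G]
  [MeasurableSpace G] [BorelSpace G] {μ : Measure G} [μ.IsHaarMeasure]
  {ρ : BanachRep.{u, v} G} {m : C_c(G, ℂ)}

theorem barycenter_coboundary (hm : ∫ g, m g ∂μ = 1) (x : ρ.E) :
    barycenter μ m (ρ.coboundary x) = x - ρ.op μ m x := by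
  have hsplit : ρ.coboundary x = (fun _ => x) - fun g => ρ.π g x := rfl
  rw [hsplit, barycenter_sub μ continuous_const (ρ.continuous_apply x), barycenter_const μ hm]
  rfl

theorem averagingOrbit_coboundary (hm : ∫ g, m g ∂μ = 1) (x : ρ.E) (n : ℕ) :
    averagingOrbit μ ρ m (ρ.coboundary x) n = x - (ρ.op μ m ^ n) x := by
  induction n with
  | zero => simp [averagingOrbit]
  | succ n ih =>
    rw [averagingOrbit_succ, ih, rebase_coboundary, sub_sub_cancel, barycenter_coboundary hm,
      pow_succ', mul_apply_eq_comp]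
    abel

theorem op_apply_of_mem_invariants (hm : ∫ g, m g ∂μ = 1) {x : ρ.E} (hx : x ∈ ρ.invariants) :
    ρ.op μ m x = x := by
  have hzero : x - ρ.op μ m x = 0 := by
    rw [← barycenter_coboundary hm, coboundary_eq_zero_iff.2 hx]
    simp [barycenter]
  exact (sub_eq_zero.1 hzero).symm

theorem op_pow_apply_of_mem_invariants (hm : ∫ g, m g ∂μ = 1) {x : ρ.E} (hx : x ∈ ρ.invariants)
    (n : ℕ) : (ρ.op μ m ^ n) x = x := by
  induction n with
  | zero => simp
  | succ n ih => rw [pow_succ', mul_apply_eq_comp, ih, op_apply_of_mem_invariants hm hx]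

theorem op_sub (f₁ f₂ : C_c(G, ℂ)) : ρ.op μ (f₁ - f₂) = ρ.op μ f₁ - ρ.op μ f₂ := by
  rw [eq_sub_iff_add_eq, ← op_add, sub_add_cancel]

variable {S : Set G} {κ M C : ℝ}

theorem Contracts.norm_op_pow_sub_le (h : Contracts μ S m κ ρ) (hm : ∫ g, m g ∂μ = 1)
    (hκ0 : 0 ≤ κ) (hS : S.Nonempty) (hρ : ∀ s ∈ S, ‖ρ.π s‖ ≤ M) (hC0 : 0 ≤ C)
    (hC : ∀ b ∈ ρ.Z1, ∀ D : ℝ, (∀ s ∈ S, ‖b s‖ ≤ D) → ‖barycenter μ m b‖ ≤ C * D) (n : ℕ) :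
    ‖ρ.op μ m ^ n - ρ.op μ m ^ (n + 1)‖ ≤ C * (1 + M) * κ ^ n := by
  obtain ⟨s, hs⟩ := hS
  have hM : 0 ≤ M := (norm_nonneg _).trans (hρ s hs)
  refine ContinuousLinearMap.opNorm_le_bound _ (by positivity) fun x => ?_
  have hstep := h.norm_averagingOrbit_sub_le hC (ρ.coboundary_mem_Z1 x)
    (fun s hs => norm_coboundary_le (hρ s hs) x) n
  rw [averagingOrbit_coboundary hm, averagingOrbit_coboundary hm, sub_sub_sub_cancel_left,
    norm_sub_rev] at hstep
  exact hstep.trans_eq (by ring)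

theorem Contracts.mem_invariants_of_tendsto (h : Contracts μ S m κ ρ) (hm : ∫ g, m g ∂μ = 1)
    (hκ0 : 0 ≤ κ) (hκ : κ < 1) (hS_gen : Subgroup.closure S = ⊤) (hρ : ∀ s ∈ S, ‖ρ.π s‖ ≤ M)
    {x y : ρ.E} (hy : Filter.Tendsto (fun n => (ρ.op μ m ^ n) x) Filter.atTop (𝓝 y)) :
    y ∈ ρ.invariants := by
  have horbit : Filter.Tendsto (averagingOrbit μ ρ m (ρ.coboundary x)) Filter.atTop
      (𝓝 (x - y)) :=
    (hy.const_sub x).congr fun n => (averagingOrbit_coboundary hm x n).symm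
  have hx : ρ.coboundary x = ρ.coboundary (x - y) :=
    eq_coboundary_of_tendsto_rebase hS_gen (ρ.coboundary_mem_Z1 x) horbit fun s hs =>
      h.tendsto_rebase_averagingOrbit hκ0 hκ (ρ.coboundary_mem_Z1 x)
        (fun s hs => norm_coboundary_le (hρ s hs) x) hs
  have hzero := ρ.rebase_coboundary x (x - y)
  rw [rebase_eq_sub_coboundary, ← hx, sub_self, sub_sub_cancel] at hzero
  exact coboundary_eq_zero_iff.1 hzero.symm

end Operators

/-! ### Kazhdan projections -/

section KazhdanProjection

variable {G : Type u} [Group G] [TopologicalSpace G] [IsTopologicalGroup G]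
  [MeasurableSpace G] [BorelSpace G] (μ : Measure G) [μ.IsHaarMeasure]

/-- The convolution power `m * ⋯ * m` with `n + 1` factors. -/
noncomputable def convPow (m : C_c(G, ℂ)) : ℕ → C_c(G, ℂ)
  | 0 => m
  | n + 1 => conv μ m (convPow m n)

variable {μ}

theorem op_convPow (ρ : BanachRep.{u, v} G) (m : C_c(G, ℂ)) (n : ℕ) :
    ρ.op μ (convPow μ m n) = ρ.op μ m ^ (n + 1) := by
  induction n with
  | zero => rw [pow_one]; rfl
  | succ n ih =>
    rw [convPow, op_conv, ih, pow_succ' _ (n + 1)]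
    rfl

theorem integral_convPow {m : C_c(G, ℂ)} (hm : ∫ g, m g ∂μ = 1) (n : ℕ) :
    ∫ g, convPow μ m n g ∂μ = 1 := by
  induction n with
  | zero => exact hm
  | succ n ih => rw [convPow, integral_conv, hm, ih, mul_one]

variable {F : Set (BanachRep.{u, v} G)} {hF : BddOnCompacts F}

theorem dist_toCF_le {f₁ f₂ : C_c(G, ℂ)} {C : ℝ} (hC : 0 ≤ C)
    (h : ∀ ρ ∈ F, ‖ρ.op μ f₁ - ρ.op μ f₂‖ ≤ C) :
    dist (toCF μ F hF f₁) (toCF μ F hF f₂) ≤ C := by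
  have hdist : dist (toCF μ F hF f₁) (toCF μ F hF f₂)
      = dist (show CcF F hF μ from f₁) (show CcF F hF μ from f₂) := Completion.dist_eq _ _
  rw [hdist, dist_eq_norm]
  exact normF_le μ hC fun ρ hρ => (congrArg norm (op_sub f₁ f₂)).trans_le (h ρ hρ)

theorem toCF_eq_of_op_eq {f₁ f₂ : C_c(G, ℂ)} (h : ∀ ρ ∈ F, ρ.op μ f₁ = ρ.op μ f₂) :
    toCF μ F hF f₁ = toCF μ F hF f₂ :=
  dist_le_zero.1 (dist_toCF_le le_rfl fun ρ hρ => by rw [h ρ hρ, sub_self, norm_zero])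

theorem toCF_convPow_mul_self (m : C_c(G, ℂ)) (n : ℕ) :
    toCF μ F hF (convPow μ m n) * toCF μ F hF (convPow μ m n)
      = toCF μ F hF (convPow μ m (2 * n + 1)) := by
  rw [toCF_mul]
  refine toCF_eq_of_op_eq fun ρ _ => ?_
  have hexp : 2 * n + 1 + 1 = (n + 1) + (n + 1) := by ring
  rw [op_conv, op_convPow, op_convPow, hexp]
  exact (pow_add _ _ _).symm

theorem isIdempotentElem_of_tendsto_convPow {m : C_c(G, ℂ)} {p : CF μ F hF}
    (hp : Filter.Tendsto (fun n => toCF μ F hF (convPow μ m n)) Filter.atTop (𝓝 p)) :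
    IsIdempotentElem p := by
  have hsq : Filter.Tendsto (fun n => toCF μ F hF (convPow μ m n) * toCF μ F hF (convPow μ m n))
      Filter.atTop (𝓝 (p * p)) :=
    (((continuous_mul_CF (hF := hF) μ).comp (continuous_id.prodMk continuous_id)).tendsto p).comp hp
  have hindex : Filter.Tendsto (fun n : ℕ => 2 * n + 1) Filter.atTop Filter.atTop :=
    Filter.tendsto_atTop_mono (fun n => by simp only [id]; omega) Filter.tendsto_id
  simp only [toCF_convPow_mul_self] at hsq
  exact tendsto_nhds_unique hsq (hp.comp hindex)

theorem tendsto_op_pow_of_tendsto_convPow {m : C_c(G, ℂ)} {p : CF μ F hF}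
    (hp : Filter.Tendsto (fun n => toCF μ F hF (convPow μ m n)) Filter.atTop (𝓝 p))
    {ρ : BanachRep.{u, v} G} (hρ : ρ ∈ F) (x : ρ.E) :
    Filter.Tendsto (fun n => (ρ.op μ m ^ n) x) Filter.atTop (𝓝 (ext μ hρ p x)) := by
  refine (Filter.tendsto_add_atTop_iff_nat 1).1 ?_
  have hext := ((ext μ hρ).continuous.tendsto p).comp hp
  refine (((ContinuousLinearMap.apply ℂ ρ.E x).continuous.tendsto _).comp hext).congr fun n => ?_
  simp only [Function.comp_apply, ext_toCF, op_convPow, ContinuousLinearMap.apply_apply]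

theorem hasKazhdanProjection_of_contracts [T2Space G] [BaireSpace G] {S : Set G}
    (hS : IsCompactGenerating S) {M : ℝ} (hFM : ∀ ρ ∈ F, ∀ s ∈ S, ‖ρ.π s‖ ≤ M) {m : C_c(G, ℂ)}
    (hm : ∫ g, m g ∂μ = 1) {κ : ℝ} (hκ0 : 0 ≤ κ) (hκ : κ < 1)
    (h : ∀ ρ ∈ F, Contracts μ S m κ ρ) : HasKazhdanProjection μ F := by
  have hF : BddOnCompacts F := bddOnCompacts_of_forall_norm_le hS hFM
  obtain ⟨C, hC0, hC⟩ := exists_norm_barycenter_le.{u, v} μ hS M m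
  have hstep : ∀ n, dist (toCF μ F hF (convPow μ m n)) (toCF μ F hF (convPow μ m (n + 1)))
      ≤ |C * (1 + M) * κ| * κ ^ n := by
    refine fun n => dist_toCF_le (by positivity) fun ρ hρ => ?_
    rw [op_convPow, op_convPow]
    refine ((h ρ hρ).norm_op_pow_sub_le hm hκ0 ⟨1, hS.one_mem⟩ (hFM ρ hρ) hC0
      (hC ρ (hFM ρ hρ)) (n + 1)).trans ?_
    rw [pow_succ', ← mul_assoc]
    exact mul_le_mul_of_nonneg_right (le_abs_self _) (by positivity)
  obtain ⟨p, hp⟩ := cauchySeq_tendsto_of_complete (cauchySeq_of_le_geometric κ _ hκ hstep)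
  refine ⟨hF, p, isIdempotentElem_of_tendsto_convPow hp, ?_, fun ρ hρ => ⟨fun x => ?_, ?_⟩⟩
  · exact mem_closure_of_tendsto hp (.of_forall fun n => ⟨_, integral_convPow hm n, rfl⟩)
  · exact (h ρ hρ).mem_invariants_of_tendsto hm hκ0 hκ hS.closure_eq_top (hFM ρ hρ)
      (tendsto_op_pow_of_tendsto_convPow hp hρ x)
  · intro x hx
    have hlim := tendsto_op_pow_of_tendsto_convPow hp hρ x
    simp only [op_pow_apply_of_mem_invariants hm hx] at hlim
    exact tendsto_nhds_unique hlim tendsto_const_nhds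

theorem norm_ext_le {ρ : BanachRep.{u, v} G} (hρ : ρ ∈ F) : ‖ext (hF := hF) μ hρ‖ ≤ 1 := by
  refine ContinuousLinearMap.opNorm_le_bound _ zero_le_one fun q => ?_
  induction q using Completion.induction_on with
  | hp => exact isClosed_le (ext μ hρ).continuous.norm (continuous_const.mul continuous_norm)
  | ih f =>
    rw [one_mul, Completion.norm_coe]
    exact (congrArg norm (ext_toCF (hF := hF) μ hρ f)).trans_le (norm_op_le_normF μ hF hρ f)

namespace IsKazhdanProjection

variable {p : CF μ F hF}

theorem exists_norm_op_sub_le (hp : IsKazhdanProjection μ p) {ε : ℝ} (hε : 0 < ε) :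
    ∃ m : C_c(G, ℂ), ∫ g, m g ∂μ = 1 ∧
      ∀ (ρ : BanachRep.{u, v} G) (hρ : ρ ∈ F), ‖ρ.op μ m - ext μ hρ p‖ ≤ ε := by
  obtain ⟨_, ⟨m, hm, rfl⟩, hd⟩ := Metric.mem_closure_iff.1 hp.mem_closure ε hε
  refine ⟨m, hm, fun ρ hρ => ?_⟩
  rw [← ext_toCF (hF := hF) μ hρ, ← map_sub]
  refine ((ext μ hρ).le_of_opNorm_le (norm_ext_le hρ) _).trans ?_
  rw [one_mul, ← dist_eq_norm, dist_comm]
  exact hd.le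

variable {ρ : BanachRep.{u, v} G} {hρ : ρ ∈ F} {m : C_c(G, ℂ)} {ε : ℝ}

theorem norm_op_apply_sub_le (hp : IsKazhdanProjection μ p) (hm : ∫ g, m g ∂μ = 1)
    (hε : ‖ρ.op μ m - ext μ hρ p‖ ≤ ε) (x : ρ.E) :
    ‖ρ.op μ m x - ext μ hρ p x‖ ≤ ε * ‖x - ext μ hρ p x‖ := by
  have hinv : ext μ hρ p x ∈ ρ.invariants := (hp.isProj ρ hρ).map_mem x
  have heq : ρ.op μ m x - ext μ hρ p x = (ρ.op μ m - ext μ hρ p) (x - ext μ hρ p x) := by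
    rw [_root_.sub_apply, map_sub, map_sub, op_apply_of_mem_invariants hm hinv,
      (hp.isProj ρ hρ).map_id _ hinv, sub_sub_sub_cancel_right]
  exact heq ▸ ContinuousLinearMap.le_of_opNorm_le _ hε _

theorem norm_sub_ext_le (hp : IsKazhdanProjection μ p) (hm : ∫ g, m g ∂μ = 1)
    (hε : ‖ρ.op μ m - ext μ hρ p‖ ≤ 1 / 2) (x : ρ.E) :
    ‖x - ext μ hρ p x‖ ≤ 2 * ‖x - ρ.op μ m x‖ := by
  have htri := norm_sub_le_norm_sub_add_norm_sub x (ρ.op μ m x) (ext μ hρ p x)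
  linarith [hp.norm_op_apply_sub_le hm hε x]

theorem norm_coboundary_op_le (hp : IsKazhdanProjection μ p) (hm : ∫ g, m g ∂μ = 1)
    (hε : ‖ρ.op μ m - ext μ hρ p‖ ≤ ε) {s : G} {M : ℝ} (hs : ‖ρ.π s‖ ≤ M) (x : ρ.E) :
    ‖ρ.coboundary (ρ.op μ m x) s‖ ≤ (1 + M) * (ε * ‖x - ext μ hρ p x‖) := by
  have hinv : ρ.coboundary (ext μ hρ p x) = 0 :=
    coboundary_eq_zero_iff.2 ((hp.isProj ρ hρ).map_mem x)
  have heq : ρ.coboundary (ρ.op μ m x) = ρ.coboundary (ρ.op μ m x - ext μ hρ p x) := by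
    rw [← rebase_coboundary, rebase_eq_sub_coboundary, hinv, sub_zero]
  have hM : 0 ≤ M := (norm_nonneg _).trans hs
  rw [heq]
  exact (norm_coboundary_le hs _).trans
    (mul_le_mul_of_nonneg_left (hp.norm_op_apply_sub_le hm hε x) (by positivity))

end IsKazhdanProjection

theorem HasKazhdanProjection.exists_contracts [T2Space G] [BaireSpace G] {S : Set G}
    (hS : IsCompactGenerating S) {M : ℝ} (hFM : ∀ ρ ∈ F, ∀ s ∈ S, ‖ρ.π s‖ ≤ M)
    (hF : HasKazhdanProjection μ F) (hH1 : ∀ ρ ∈ F, Subsingleton ρ.H1) {κ : ℝ} (hκ : 0 < κ) :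
    ∃ m : C_c(G, ℂ), ∫ g, m g ∂μ = 1 ∧ ∀ ρ ∈ F, Contracts μ S m κ ρ := by
  obtain ⟨hF, p, hp⟩ := hF
  obtain ⟨m₀, hm₀, hm₀p⟩ := hp.exists_norm_op_sub_le (ε := 1 / 2) (by norm_num)
  obtain ⟨C, _, hC⟩ := exists_norm_barycenter_le.{u, v} μ hS M m₀
  obtain ⟨ε, hε, hεκ⟩ := exists_pos_mul_lt hκ ((1 + M) * (2 * C))
  obtain ⟨m, hm, hmp⟩ := hp.exists_norm_op_sub_le hε
  refine ⟨m, hm, fun ρ hρ b hb hb1 s hs => ?_⟩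
  obtain ⟨x, rfl⟩ := subsingleton_H1_iff.1 (hH1 ρ hρ) b hb
  have hM : 0 ≤ M := (norm_nonneg _).trans (hFM ρ hρ s hs)
  have hdist : ‖x - ext μ hρ p x‖ ≤ 2 * C := by
    have hbary := hC ρ (hFM ρ hρ) _ hb 1 hb1
    rw [barycenter_coboundary hm₀, mul_one] at hbary
    linarith [hp.norm_sub_ext_le hm₀ (hm₀p ρ hρ) x]
  rw [barycenter_coboundary hm, rebase_coboundary, sub_sub_cancel]
  calc ‖ρ.coboundary (ρ.op μ m x) s‖ ≤ (1 + M) * (ε * ‖x - ext μ hρ p x‖) :=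
        hp.norm_coboundary_op_le hm (hmp ρ hρ) (hFM ρ hρ s hs) x
    _ ≤ (1 + M) * (ε * (2 * C)) := by gcongr
    _ = (1 + M) * (2 * C) * ε := by ring
    _ ≤ κ := hεκ.le

end KazhdanProjection

end BanachRep

/-! ### Ultralimits of normed spaces -/

section Ultralimit

open Filter

universe w w'

variable {𝕜 : Type*} [NontriviallyNormedField 𝕜]

theorem exists_tendsto_ultrafilter_of_norm_le {X : Type*} (𝒰 : Ultrafilter X) {E : Type*}
    [SeminormedAddCommGroup E] [ProperSpace E] {f : X → E} {B : ℝ} (hf : ∀ c, ‖f c‖ ≤ B) :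
    ∃ x, Tendsto f 𝒰 (𝓝 x) := by
  obtain ⟨x, -, hx⟩ := (isCompact_closedBall (0 : E) B).ultrafilter_le_nhds (𝒰.map f)
    (le_principal_iff.2 (mem_map.2 (univ_mem' fun c => mem_closedBall_zero_iff.2 (hf c))))
  exact ⟨x, hx⟩

theorem exists_denseRange_tendsto_norm {X : Type*} (𝒰 : Ultrafilter X) {E : X → Type w'}
    [∀ c, SeminormedAddCommGroup (E c)] [∀ c, NormedSpace 𝕜 (E c)] {V : Type w} [AddCommGroup V]
    [Module 𝕜 V] (L : ∀ c, V →ₗ[𝕜] E c) (hL : ∀ a, ∃ B, ∀ c, ‖L c a‖ ≤ B) :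
    ∃ (E' : Type w) (_ : NormedAddCommGroup E') (_ : NormedSpace 𝕜 E') (_ : CompleteSpace E')
      (ι : V →ₗ[𝕜] E'), DenseRange ι ∧ ∀ a, Tendsto (fun c => ‖L c a‖) 𝒰 (𝓝 ‖ι a‖) := by
  have hlim : ∀ a, ∃ r, Tendsto (fun c => ‖L c a‖) 𝒰 (𝓝 r) := fun a => by
    obtain ⟨B, hB⟩ := hL a
    exact exists_tendsto_ultrafilter_of_norm_le 𝒰 fun c => (norm_norm _).trans_le (hB c)
  choose N hN using hlim
  let : Norm V := ⟨N⟩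
  have core : SeminormedSpace.Core 𝕜 V :=
    { norm_nonneg := fun a => ge_of_tendsto' (hN a) fun c => norm_nonneg _
      norm_smul := fun t a => by
        refine tendsto_nhds_unique (hN (t • a)) (((hN a).const_mul ‖t‖).congr fun c => ?_)
        rw [map_smul, norm_smul]
      norm_triangle := fun a b =>
        le_of_tendsto_of_tendsto' (hN (a + b)) ((hN a).add (hN b)) fun c => by
          rw [map_add]
          exact norm_add_le _ _ }
  let : SeminormedAddCommGroup V := SeminormedAddCommGroup.ofCore core
  let : NormedSpace 𝕜 V := ⟨fun t a => (core.norm_smul t a).le⟩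
  refine ⟨Completion V, inferInstance, inferInstance, inferInstance,
    (Completion.toComplL (𝕜 := 𝕜) (E := V)).toLinearMap, Completion.denseRange_coe, fun a => ?_⟩
  have hnorm : ‖(Completion.toComplL (𝕜 := 𝕜) (E := V)).toLinearMap a‖ = N a :=
    Completion.norm_coe a
  exact hnorm ▸ hN a

theorem small_of_separableSpace (E : Type w) [MetricSpace E] [TopologicalSpace.SeparableSpace E] :
    Small.{w'} E := by
  rcases isEmpty_or_nonempty E with hE | hE
  · exact small_of_injective (f := fun x : E => (hE.elim x : PEmpty.{w' + 1})) fun x => hE.elim x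
  · refine small_of_injective
      (f := fun (x : E) (n : ℕ) => dist x (TopologicalSpace.denseSeq E n)) fun x y hxy => ?_
    have hdist : ∀ z, dist x z = dist y z := fun z =>
      (TopologicalSpace.denseRange_denseSeq E).induction_on z
        (isClosed_eq (by fun_prop) (by fun_prop)) fun n => congrFun hxy n
    exact dist_eq_zero.1 ((hdist y).trans (dist_self y))

variable (𝕜) in
theorem exists_linearIsometryEquiv_of_separableSpace (E : Type w) [NormedAddCommGroup E]
    [NormedSpace 𝕜 E] [CompleteSpace E] [TopologicalSpace.SeparableSpace E] :
    ∃ (E' : Type w') (_ : NormedAddCommGroup E') (_ : NormedSpace 𝕜 E') (_ : CompleteSpace E'),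
      Nonempty (E ≃ₗᵢ[𝕜] E') := by
  have : Small.{w'} E := small_of_separableSpace E
  let e : Shrink.{w'} E ≃ₗ[𝕜] E := Shrink.linearEquiv 𝕜 E
  let hgroup : NormedAddCommGroup (Shrink.{w'} E) := NormedAddCommGroup.induced _ E e e.injective
  let hspace : NormedSpace 𝕜 (Shrink.{w'} E) := NormedSpace.induced 𝕜 (Shrink.{w'} E) E e
  let T : E ≃ₗᵢ[𝕜] Shrink.{w'} E :=
    { e.symm with
      norm_map' := fun x => congrArg norm (e.apply_symm_apply x) }
  exact ⟨Shrink.{w'} E, hgroup, hspace,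
    (T.symm.isometry.isUniformInducing.completeSpace_congr T.symm.surjective).2 inferInstance, ⟨T⟩⟩

end Ultralimit

/-! ### Extending operators from a dense subspace -/

section DenseRange

open Filter

variable {𝕜 E : Type*} [NontriviallyNormedField 𝕜] [NormedAddCommGroup E] [NormedSpace 𝕜 E]

theorem tendsto_apply_of_denseRange {α β : Type*} {l : Filter α} {ι : β → E} (hι : DenseRange ι)
    {T : α → E →L[𝕜] E} {T₀ : E →L[𝕜] E} {C : ℝ} (hT : ∀ᶠ i in l, ‖T i‖ ≤ C)
    (h : ∀ a, Tendsto (fun i => T i (ι a)) l (𝓝 (T₀ (ι a)))) (x : E) :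
    Tendsto (fun i => T i x) l (𝓝 (T₀ x)) := by
  refine Metric.tendsto_nhds.2 fun ε hε => ?_
  obtain ⟨δ, hδ, hδε⟩ := exists_pos_mul_lt (half_pos hε) (|C| + ‖T₀‖)
  obtain ⟨a, ha⟩ := hι.exists_dist_lt x hδ
  filter_upwards [hT, Metric.tendsto_nhds.1 (h a) (ε / 2) (half_pos hε)] with i hi hia
  rw [dist_eq_norm] at ha hia ⊢
  have hsplit : T i x - T₀ x = (T i (x - ι a) - T₀ (x - ι a)) + (T i (ι a) - T₀ (ι a)) := by
    simp only [map_sub]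
    abel
  calc ‖T i x - T₀ x‖ ≤ (|C| * δ + ‖T₀‖ * δ) + ‖T i (ι a) - T₀ (ι a)‖ := by
        rw [hsplit]
        exact norm_add_le_of_le (norm_sub_le_of_le
          ((T i).le_of_opNorm_le_of_le (hi.trans (le_abs_self C)) ha.le)
          (T₀.le_of_opNorm_le_of_le le_rfl ha.le)) le_rfl
    _ < ε := by linarith

theorem exists_monoidHom_of_denseRange [CompleteSpace E] {G V : Type*} [Monoid G]
    [AddCommGroup V] [Module 𝕜 V] {ι : V →ₗ[𝕜] E} (hι : DenseRange ι) {A : G → V →ₗ[𝕜] V}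
    (hone : ∀ a, ι (A 1 a) = ι a)
    (hmul : ∀ g h a, ι (A (g * h) a) = ι (A g (A h a)))
    (hbdd : ∀ g, ∃ C, ∀ a, ‖ι (A g a)‖ ≤ C * ‖ι a‖) :
    ∃ π : G →* (E →L[𝕜] E), ∀ g a, π g (ι a) = ι (A g a) := by
  have hext : ∀ g a, (ι ∘ₗ A g).extendOfNorm ι (ι a) = ι (A g a) := fun g a =>
    LinearMap.extendOfNorm_eq hι (hbdd g) a
  refine ⟨⟨⟨fun g => (ι ∘ₗ A g).extendOfNorm ι, ?_⟩, fun g h => ?_⟩, hext⟩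
  · ext x
    refine hι.induction_on x (isClosed_eq (by fun_prop) (by fun_prop)) fun a => ?_
    rw [hext, hone]
    rfl
  · ext x
    refine hι.induction_on x (isClosed_eq (by fun_prop) (by fun_prop)) fun a => ?_
    rw [hext, hmul, mul_apply_eq_comp, hext, hext]

variable {G : Type*} [Group G] [TopologicalSpace G] [ContinuousMul G]

theorem continuous_of_cocycle_of_tendsto {π : G →* (E →L[𝕜] E)} {b : G → E}
    (hb : ∀ g h, b (g * h) = b g + π g (b h)) (h : Tendsto b (𝓝 1) (𝓝 0)) : Continuous b := by
  refine continuous_iff_continuousAt.2 fun g => ?_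
  have hinv : Tendsto (fun k => g⁻¹ * k) (𝓝 g) (𝓝 1) := by
    simpa using (continuous_const_mul g⁻¹).tendsto g
  have hlim : Tendsto (fun k => b g + π g (b (g⁻¹ * k))) (𝓝 g) (𝓝 (b g + π g 0)) :=
    tendsto_const_nhds.add (((π g).continuous.tendsto 0).comp (h.comp hinv))
  rw [map_zero, add_zero] at hlim
  exact hlim.congr fun k => by rw [← hb, mul_inv_cancel_left]

theorem continuous_apply_of_tendsto_one {π : G →* (E →L[𝕜] E)} {x : E}
    (h : Tendsto (fun g => π g x) (𝓝 1) (𝓝 x)) : Continuous fun g => π g x := by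
  have hcoc : Continuous fun g => π g x - x := by
    refine continuous_of_cocycle_of_tendsto (π := π) (fun g k => ?_) ?_
    · rw [map_mul, mul_apply_eq_comp, map_sub]
      abel
    · simpa using h.sub_const x
  simpa using hcoc.add_const x

end DenseRange

namespace BanachRep

/-! ### Limits of representations along cocycles -/

section CocycleShift

variable {G : Type u} [Group G]

/-- The operator `[h] ↦ [g h] - [g]` on finitely supported functions. The map `[h] ↦ b h` defined by
a cocycle `b` intertwines it with `π(g)`, see `linearCombination_cocycleShift`. -/
noncomputable def cocycleShift (g : G) : (G →₀ ℂ) →ₗ[ℂ] (G →₀ ℂ) :=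
  Finsupp.linearCombination ℂ fun h => Finsupp.single (g * h) 1 - Finsupp.single g 1

theorem cocycleShift_single (g h : G) :
    cocycleShift g (Finsupp.single h 1) = Finsupp.single (g * h) 1 - Finsupp.single g 1 := by
  rw [cocycleShift, Finsupp.linearCombination_single, one_smul]

theorem linearCombination_cocycleShift [TopologicalSpace G] {ρ : BanachRep.{u, v} G} {b : G → ρ.E}
    (hb : b ∈ ρ.Z1) (g : G) (a : G →₀ ℂ) :
    Finsupp.linearCombination ℂ b (cocycleShift g a) = ρ.π g (Finsupp.linearCombination ℂ b a) := by
  have hcomp : Finsupp.linearCombination ℂ b ∘ₗ cocycleShift g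
      = (ρ.π g).toLinearMap ∘ₗ Finsupp.linearCombination ℂ b := by
    ext h
    simp [cocycleShift_single, hb.2]
  exact LinearMap.congr_fun hcomp a

theorem apply_cocycle_sub_self [TopologicalSpace G] {ρ : BanachRep.{u, v} G} {b : G → ρ.E}
    (hb : b ∈ ρ.Z1) (g h : G) : ρ.π g (b h) - b h = ρ.π h (b (h⁻¹ * g * h)) - b g := by
  have hcomm := hb.2 h (h⁻¹ * g * h)
  rw [← mul_assoc, ← mul_assoc, mul_inv_cancel, one_mul, hb.2 g h] at hcomm
  rw [sub_eq_sub_iff_add_eq_add, add_comm, hcomm, add_comm]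

end CocycleShift

section CocycleLimit

open Filter

variable {G : Type u} [Group G] [TopologicalSpace G] {X : Type*}

/-- Cocycles `b c` of a family `ρ` of representations which are equicontinuous and pointwise
bounded, the representations being bounded on compact sets. -/
structure EquicontinuousCocycles (ρ : X → BanachRep.{u, v} G) (b : ∀ c, G → (ρ c).E) : Prop where
  bddOnCompacts : BddOnCompacts (Set.range ρ)
  mem_Z1 : ∀ c, b c ∈ (ρ c).Z1
  exists_norm_le : ∀ g, ∃ B, ∀ c, ‖b c g‖ ≤ B
  eventually_norm_le : ∀ ε > 0, ∀ᶠ g in 𝓝 (1 : G), ∀ c, ‖b c g‖ ≤ ε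

/-- The map `ι` exhibits the action `π` on `E` as the limit along `l` of the subrepresentations of
the `ρ c` spanned by the values of the cocycles `b c`: the vector `ι a` is the limit of the vectors
`∑ a(g) b c g`. -/
structure IsCocycleLimit (l : Filter X) (ρ : X → BanachRep.{u, v} G) (b : ∀ c, G → (ρ c).E)
    {E : Type*} [NormedAddCommGroup E] [NormedSpace ℂ E] (π : G →* (E →L[ℂ] E))
    (ι : (G →₀ ℂ) →ₗ[ℂ] E) : Prop where
  denseRange : DenseRange ι
  map_apply : ∀ g a, π g (ι a) = ι (cocycleShift g a)
  tendsto_norm : ∀ a, Tendsto (fun c => ‖Finsupp.linearCombination ℂ (b c) a‖) l (𝓝 ‖ι a‖)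

/-- The limit `g ↦ lim b c g` of the cocycles `b c` along which a limit is formed. -/
noncomputable def limitCocycle {E : Type*} [NormedAddCommGroup E] [NormedSpace ℂ E]
    (ι : (G →₀ ℂ) →ₗ[ℂ] E) (g : G) : E :=
  ι (Finsupp.single g 1)

variable {ρ : X → BanachRep.{u, v} G} {b : ∀ c, G → (ρ c).E}

theorem EquicontinuousCocycles.exists_norm_linearCombination_le (hb : EquicontinuousCocycles ρ b)
    (a : G →₀ ℂ) : ∃ B, ∀ c, ‖Finsupp.linearCombination ℂ (b c) a‖ ≤ B := by
  choose B hB using hb.exists_norm_le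
  refine ⟨∑ g ∈ a.support, ‖a g‖ * B g, fun c => ?_⟩
  rw [Finsupp.linearCombination_apply, Finsupp.sum]
  refine (norm_sum_le _ _).trans (Finset.sum_le_sum fun g _ => ?_)
  rw [norm_smul]
  exact mul_le_mul_of_nonneg_left (hB g c) (norm_nonneg _)

theorem EquicontinuousCocycles.eventually_norm_apply_sub_le [ContinuousMul G]
    (hb : EquicontinuousCocycles ρ b) (h : G) {ε : ℝ} (hε : 0 < ε) :
    ∀ᶠ g in 𝓝 (1 : G), ∀ c, ‖(ρ c).π g (b c h) - b c h‖ ≤ ε := by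
  obtain ⟨C, hC⟩ := hb.bddOnCompacts {h} isCompact_singleton
  have hconj : Tendsto (fun g => h⁻¹ * g * h) (𝓝 1) (𝓝 1) := by
    have hcont : Continuous fun g => h⁻¹ * g * h := by fun_prop
    simpa using hcont.tendsto 1
  obtain ⟨η, hη, hηε⟩ := exists_pos_mul_lt hε (C + 1)
  filter_upwards [hb.eventually_norm_le η hη, hconj.eventually (hb.eventually_norm_le η hη)]
    with g hg hgh c
  rw [apply_cocycle_sub_self (hb.mem_Z1 c)]
  refine (norm_sub_le_of_le
    (((ρ c).π h).le_of_opNorm_le_of_le (hC _ ⟨c, rfl⟩ h rfl) (hgh c)) (hg c)).trans ?_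
  linarith

theorem EquicontinuousCocycles.eventually_norm_apply_linearCombination_sub_le [ContinuousMul G]
    (hb : EquicontinuousCocycles ρ b) (a : G →₀ ℂ) {ε : ℝ} (hε : 0 < ε) :
    ∀ᶠ g in 𝓝 (1 : G), ∀ c, ‖(ρ c).π g (Finsupp.linearCombination ℂ (b c) a)
      - Finsupp.linearCombination ℂ (b c) a‖ ≤ ε := by
  induction a using Finsupp.induction_linear generalizing ε with
  | zero => exact .of_forall fun g c => by simpa using hε.le
  | add a₁ a₂ h₁ h₂ =>
    filter_upwards [h₁ (half_pos hε), h₂ (half_pos hε)] with g hg₁ hg₂ c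
    rw [map_add, map_add, add_sub_add_comm]
    exact (norm_add_le_of_le (hg₁ c) (hg₂ c)).trans (add_halves ε).le
  | single h t =>
    obtain ⟨η, hη, hηε⟩ := exists_pos_mul_lt hε ‖t‖
    filter_upwards [hb.eventually_norm_apply_sub_le h hη] with g hg c
    rw [Finsupp.linearCombination_single, map_smul, ← smul_sub, norm_smul]
    exact (mul_le_mul_of_nonneg_left (hg c) (norm_nonneg t)).trans hηε.le

variable {l : Filter X} {E : Type*} [NormedAddCommGroup E] [NormedSpace ℂ E]
  {π : G →* (E →L[ℂ] E)} {ι : (G →₀ ℂ) →ₗ[ℂ] E}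

theorem IsCocycleLimit.limitCocycle_mul (h : IsCocycleLimit l ρ b π ι) (g k : G) :
    limitCocycle ι (g * k) = limitCocycle ι g + π g (limitCocycle ι k) := by
  simp only [limitCocycle, h.map_apply, cocycleShift_single, map_sub, add_sub_cancel]

variable [l.NeBot]

theorem EquicontinuousCocycles.exists_isCocycleLimit [CompleteSpace E]
    (hb : EquicontinuousCocycles ρ b) (hι : DenseRange ι)
    (hlim : ∀ a, Tendsto (fun c => ‖Finsupp.linearCombination ℂ (b c) a‖) l (𝓝 ‖ι a‖)) :
    ∃ π : G →* (E →L[ℂ] E), IsCocycleLimit l ρ b π ι := by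
  have heq : ∀ a a' : G →₀ ℂ, (∀ c, Finsupp.linearCombination ℂ (b c) a
      = Finsupp.linearCombination ℂ (b c) a') → ι a = ι a' := by
    intro a a' h
    rw [← sub_eq_zero, ← map_sub, ← norm_le_zero_iff]
    exact le_of_tendsto' (hlim _) fun c => by rw [map_sub, h c, sub_self, norm_zero]
  have hshift := fun c => linearCombination_cocycleShift (hb.mem_Z1 c)
  obtain ⟨π, hπ⟩ := exists_monoidHom_of_denseRange hι (A := cocycleShift)
    (fun a => heq _ _ fun c => by rw [hshift, map_one]; rfl)
    (fun g h a => heq _ _ fun c => by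
      rw [hshift, hshift, hshift, map_mul, mul_apply_eq_comp])
    (fun g => by
      obtain ⟨C, hC⟩ := hb.bddOnCompacts {g} isCompact_singleton
      refine ⟨C, fun a => le_of_tendsto_of_tendsto' (hlim _) ((hlim a).const_mul C) fun c => ?_⟩
      rw [hshift]
      exact ((ρ c).π g).le_of_opNorm_le (hC _ ⟨c, rfl⟩ g rfl) _)
  exact ⟨π, hι, hπ, hlim⟩

namespace IsCocycleLimit

theorem norm_le (h : IsCocycleLimit l ρ b π ι) {a : G →₀ ℂ} {r : ℝ}
    (hr : ∀ c, ‖Finsupp.linearCombination ℂ (b c) a‖ ≤ r) : ‖ι a‖ ≤ r :=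
  le_of_tendsto' (h.tendsto_norm a) hr

theorem opNorm_le (h : IsCocycleLimit l ρ b π ι) (hb : ∀ c, b c ∈ (ρ c).Z1) {g : G} {C : ℝ}
    (hC : ∀ c, ‖(ρ c).π g‖ ≤ C) : ‖π g‖ ≤ C := by
  obtain ⟨c⟩ := l.nonempty_of_neBot
  refine ContinuousLinearMap.opNorm_le_bound _ ((norm_nonneg _).trans (hC c)) fun x => ?_
  refine h.denseRange.induction_on x (isClosed_le (by fun_prop) (by fun_prop)) fun a => ?_
  rw [h.map_apply]
  refine le_of_tendsto_of_tendsto' (h.tendsto_norm _) ((h.tendsto_norm a).const_mul C) fun c => ?_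
  rw [linearCombination_cocycleShift (hb c)]
  exact ((ρ c).π g).le_of_opNorm_le (hC c) _

theorem norm_limitCocycle_le (h : IsCocycleLimit l ρ b π ι) {g : G} {D : ℝ}
    (hD : ∀ c, ‖b c g‖ ≤ D) : ‖limitCocycle ι g‖ ≤ D :=
  h.norm_le fun c => by simpa using hD c

theorem norm_apply_sub_le (h : IsCocycleLimit l ρ b π ι) (hb : ∀ c, b c ∈ (ρ c).Z1) {g : G}
    {a : G →₀ ℂ} {η : ℝ} (hη : ∀ c, ‖(ρ c).π g (Finsupp.linearCombination ℂ (b c) a)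
      - Finsupp.linearCombination ℂ (b c) a‖ ≤ η) : ‖π g (ι a) - ι a‖ ≤ η := by
  rw [h.map_apply, ← map_sub]
  refine h.norm_le fun c => ?_
  rw [map_sub, linearCombination_cocycleShift (hb c)]
  exact hη c

variable [ContinuousMul G]

theorem continuous_limitCocycle (h : IsCocycleLimit l ρ b π ι) (hb : EquicontinuousCocycles ρ b) :
    Continuous (limitCocycle ι) := by
  refine continuous_of_cocycle_of_tendsto h.limitCocycle_mul (Metric.tendsto_nhds.2 fun ε hε => ?_)
  filter_upwards [hb.eventually_norm_le (ε / 2) (half_pos hε)] with g hg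
  rw [dist_zero_right]
  exact (h.norm_limitCocycle_le hg).trans_lt (half_lt_self hε)

theorem separableSpace [TopologicalSpace.SeparableSpace G] (h : IsCocycleLimit l ρ b π ι)
    (hb : EquicontinuousCocycles ρ b) : TopologicalSpace.SeparableSpace E := by
  have hspan : (Submodule.span ℂ (Set.range (limitCocycle ι)) : Set E) = Set.range ι := by
    have hι : Finsupp.linearCombination ℂ (limitCocycle ι) = ι := by
      ext g
      simp [limitCocycle]
    rw [← Finsupp.range_linearCombination, hι]
    rfl
  have hsep := (TopologicalSpace.isSeparable_range (h.continuous_limitCocycle hb)).span (R := ℂ)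
    |>.closure
  rw [hspan, h.denseRange.closure_range] at hsep
  exact TopologicalSpace.isSeparable_univ_iff.1 hsep

theorem tendsto_apply_one (h : IsCocycleLimit l ρ b π ι) (hb : EquicontinuousCocycles ρ b)
    (a : G →₀ ℂ) : Tendsto (fun g => π g (ι a)) (𝓝 1) (𝓝 (ι a)) := by
  refine Metric.tendsto_nhds.2 fun ε hε => ?_
  filter_upwards [hb.eventually_norm_apply_linearCombination_sub_le a (half_pos hε)] with g hg
  rw [dist_eq_norm]
  exact (h.norm_apply_sub_le hb.mem_Z1 hg).trans_lt (half_lt_self hε)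

theorem continuous_apply [WeaklyLocallyCompactSpace G] (h : IsCocycleLimit l ρ b π ι)
    (hb : EquicontinuousCocycles ρ b) (x : E) : Continuous fun g => π g x := by
  obtain ⟨K, hK, hK1⟩ := exists_compact_mem_nhds (1 : G)
  obtain ⟨C, hC⟩ := hb.bddOnCompacts K hK
  have hbdd : ∀ᶠ g in 𝓝 (1 : G), ‖π g‖ ≤ C := by
    filter_upwards [hK1] with g hg
    exact h.opNorm_le hb.mem_Z1 fun c => hC _ ⟨c, rfl⟩ g hg
  exact continuous_apply_of_tendsto_one (tendsto_apply_of_denseRange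
    (T₀ := ContinuousLinearMap.id ℂ E) h.denseRange hbdd (h.tendsto_apply_one hb) x)

end IsCocycleLimit

theorem EquicontinuousCocycles.exists_separable_limit [ContinuousMul G]
    [WeaklyLocallyCompactSpace G] [TopologicalSpace.SeparableSpace G] (𝒰 : Ultrafilter X)
    (hb : EquicontinuousCocycles ρ b) :
    ∃ (ρ' : BanachRep.{u, v} G) (ι : (G →₀ ℂ) →ₗ[ℂ] ρ'.E),
      TopologicalSpace.SeparableSpace ρ'.E ∧ IsCocycleLimit 𝒰 ρ b ρ'.π ι := by
  obtain ⟨E₁, _, _, _, ι₁, hι₁, hlim₁⟩ := exists_denseRange_tendsto_norm 𝒰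
    (fun c => Finsupp.linearCombination ℂ (b c)) hb.exists_norm_linearCombination_le
  obtain ⟨π₁, hπ₁⟩ := hb.exists_isCocycleLimit hι₁ hlim₁
  have : TopologicalSpace.SeparableSpace E₁ := hπ₁.separableSpace hb
  obtain ⟨E', _, _, _, ⟨T⟩⟩ := exists_linearIsometryEquiv_of_separableSpace.{u, v} ℂ E₁
  obtain ⟨π, hπ⟩ := hb.exists_isCocycleLimit (ι := T.toLinearEquiv.toLinearMap ∘ₗ ι₁)
    (T.surjective.denseRange.comp hι₁ T.continuous)
    fun a => (T.norm_map (ι₁ a)).symm ▸ hlim₁ a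
  exact ⟨⟨E', π, hπ.continuous_apply hb⟩, _, hπ.separableSpace hb, hπ⟩

end CocycleLimit

/-! ### Riemann sums -/

/-- A finite partition of unity on `Q` by functions supported in left translates of `U` by points of
`Q`. It discretizes integrals over `Q` with nodes that do not depend on the integrand. -/
structure TranslatePartition {G : Type u} [Group G] [TopologicalSpace G] (Q U : Set G) where
  card : ℕ
  node : Fin card → G
  bump : Fin card → C(G, ℝ)
  node_mem : ∀ j, node j ∈ Q
  bump_mem_Icc : ∀ j g, bump j g ∈ Set.Icc (0 : ℝ) 1
  sum_bump : ∀ g ∈ Q, ∑ j, bump j g = 1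
  mem_of_bump_ne_zero : ∀ j g, bump j g ≠ 0 → (node j)⁻¹ * g ∈ U

namespace TranslatePartition

variable {G : Type u} [Group G] [TopologicalSpace G] {Q U : Set G}

theorem nonempty [ContinuousMul G] [T2Space G] [LocallyCompactSpace G] (hQ : IsCompact Q)
    (hU : U ∈ 𝓝 (1 : G)) : Nonempty (TranslatePartition Q U) := by
  obtain ⟨V, hVU, hVo, hV1⟩ := mem_nhds_iff.1 hU
  have hVopen : ∀ g : G, IsOpen ((fun k => g⁻¹ * k) ⁻¹' V) := fun g =>
    hVo.preimage (continuous_const_mul g⁻¹)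
  obtain ⟨T, hTQ, hTcover⟩ := hQ.elim_nhds_subcover (fun g => (fun k => g⁻¹ * k) ⁻¹' V)
    fun g _ => (hVopen g).mem_nhds (by simpa using hV1)
  let t : Fin T.card → G := fun j => T.equivFin.symm j
  have hcover : Q ⊆ ⋃ j, (fun k => (t j)⁻¹ * k) ⁻¹' V := by
    intro g hg
    obtain ⟨i, hi, hgi⟩ := Set.mem_iUnion₂.1 (hTcover hg)
    exact Set.mem_iUnion.2 ⟨T.equivFin ⟨i, hi⟩, by simpa [t] using hgi⟩
  obtain ⟨ψ, hψsupp, hψsum, hψIcc, -⟩ :=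
    exists_continuous_sum_one_of_isOpen_isCompact (fun j => hVopen (t j)) hQ hcover
  exact ⟨⟨T.card, t, ψ, fun j => hTQ _ (T.equivFin.symm j).2, hψIcc,
    fun g hg => by simpa using hψsum hg,
    fun j g hg => hVU (hψsupp j (subset_tsupport _ hg))⟩⟩

variable (P : TranslatePartition Q U)

theorem norm_bump (j : Fin P.card) (g : G) : ‖(P.bump j g : ℂ)‖ = P.bump j g := by
  rw [Complex.norm_real, Real.norm_of_nonneg (P.bump_mem_Icc j g).1]

variable {P} {E : Type*} [NormedAddCommGroup E] [NormedSpace ℂ E] {φ : G → E} {η : ℝ}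

theorem norm_smul_sub_sum_le {f : C_c(G, ℂ)} (hf : tsupport f ⊆ Q)
    (hη : ∀ j, ∀ k ∈ U, ‖φ (P.node j * k) - φ (P.node j)‖ ≤ η) (g : G) :
    ‖f g • φ g - ∑ j, (f g * (P.bump j g : ℂ)) • φ (P.node j)‖ ≤ ‖f g‖ * η := by
  by_cases hg : g ∈ tsupport f
  swap
  · simp [image_eq_zero_of_notMem_tsupport hg]
  have hsum := P.sum_bump g (hf hg)
  have hφ : φ g = ∑ j, (P.bump j g : ℂ) • φ g := by
    rw [← Finset.sum_smul, ← Complex.ofReal_sum, hsum, Complex.ofReal_one, one_smul]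
  have hbump : ∀ j, ‖(P.bump j g : ℂ) • (φ g - φ (P.node j))‖ ≤ P.bump j g * η := by
    intro j
    rcases eq_or_ne (P.bump j g) 0 with h0 | h0
    · simp [h0]
    · have hclose := hη j _ (P.mem_of_bump_ne_zero j g h0)
      rw [mul_inv_cancel_left] at hclose
      rw [norm_smul, norm_bump]
      exact mul_le_mul_of_nonneg_left hclose (P.bump_mem_Icc j g).1
  simp only [mul_smul]
  rw [← Finset.smul_sum, ← smul_sub, norm_smul]
  refine mul_le_mul_of_nonneg_left ?_ (norm_nonneg _)
  calc ‖φ g - ∑ j, (P.bump j g : ℂ) • φ (P.node j)‖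
      = ‖∑ j, (P.bump j g : ℂ) • (φ g - φ (P.node j))‖ := by
        simp only [smul_sub, Finset.sum_sub_distrib, ← hφ]
    _ ≤ ∑ j, P.bump j g * η := norm_sum_le_of_le _ fun j _ => hbump j
    _ = η := by rw [← Finset.sum_mul, hsum, one_mul]

variable [MeasurableSpace G] (μ : Measure G) (P) (f : C_c(G, ℂ))

/-- The weight of the node `P.node j` in the Riemann sum approximating `φ ↦ ∫ f φ`. -/
noncomputable def weight (j : Fin P.card) : ℂ := ∫ g, f g * (P.bump j g : ℂ) ∂μ

variable [BorelSpace G] [IsFiniteMeasureOnCompacts μ]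

theorem norm_weight_le (j : Fin P.card) : ‖P.weight μ f j‖ ≤ ∫ g, ‖f g‖ ∂μ := by
  refine norm_integral_le_of_norm_le (integrable_cc μ f).norm (.of_forall fun g => ?_)
  rw [norm_mul, norm_bump]
  exact mul_le_of_le_one_right (norm_nonneg _) (P.bump_mem_Icc j g).2

theorem integrable_mul_bump (j : Fin P.card) : Integrable (fun g => f g * (P.bump j g : ℂ)) μ :=
  (f.continuous.mul (Complex.continuous_ofReal.comp (P.bump j).continuous))
    |>.integrable_of_hasCompactSupport f.hasCompactSupport.mul_right

variable {P f}

theorem norm_barycenter_sub_sum_le [CompleteSpace E] (hf : tsupport f ⊆ Q) (hφ : Continuous φ)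
    (hη : ∀ j, ∀ k ∈ U, ‖φ (P.node j * k) - φ (P.node j)‖ ≤ η) :
    ‖barycenter μ f φ - ∑ j, P.weight μ f j • φ (P.node j)‖ ≤ (∫ g, ‖f g‖ ∂μ) * η := by
  have hint : ∀ j, Integrable (fun g => (f g * (P.bump j g : ℂ)) • φ (P.node j)) μ := fun j =>
    (P.integrable_mul_bump μ f j).smul_const _
  simp only [weight, ← integral_smul_const]
  rw [barycenter, ← integral_finsetSum _ fun j _ => hint j,
    ← integral_sub (integrable_cc_smul μ f hφ) (integrable_finsetSum _ fun j _ => hint j),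
    ← integral_mul_const]
  exact norm_integral_le_of_norm_le ((integrable_cc μ f).norm.mul_const _)
    (.of_forall (norm_smul_sub_sum_le hf hη))

variable {ρ : BanachRep.{u, v} G} {C : ℝ}

theorem norm_barycenter_cocycle_sub_sum_le {b : G → ρ.E} (hb : b ∈ ρ.Z1) (hf : tsupport f ⊆ Q)
    (hC : ∀ g ∈ Q, ‖ρ.π g‖ ≤ C) (hη : ∀ k ∈ U, ‖b k‖ ≤ η) :
    ‖barycenter μ f b - ∑ j, P.weight μ f j • b (P.node j)‖ ≤ (∫ g, ‖f g‖ ∂μ) * (C * η) := by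
  refine P.norm_barycenter_sub_sum_le μ hf hb.1 fun j k hk => ?_
  rw [hb.2, add_sub_cancel_left]
  exact (ρ.π (P.node j)).le_of_opNorm_le_of_le (hC _ (P.node_mem j)) (hη k hk)

theorem norm_barycenter_apply_sub_sum_le {x : ρ.E} (hf : tsupport f ⊆ Q)
    (hC : ∀ g ∈ Q, ‖ρ.π g‖ ≤ C) (hη : ∀ k ∈ U, ‖ρ.π k x - x‖ ≤ η) :
    ‖barycenter μ f (fun g => ρ.π g x) - ∑ j, P.weight μ f j • ρ.π (P.node j) x‖
      ≤ (∫ g, ‖f g‖ ∂μ) * (C * η) := by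
  refine P.norm_barycenter_sub_sum_le μ hf (ρ.continuous_apply x) fun j k hk => ?_
  rw [map_mul, mul_apply_eq_comp, ← map_sub]
  exact (ρ.π (P.node j)).le_of_opNorm_le_of_le (hC _ (P.node_mem j)) (hη k hk)

end TranslatePartition

section LimitsTo

open Filter

variable {G : Type u} [Group G] [TopologicalSpace G] {X : Type*} {l : Filter X}
  {ρ : X → BanachRep.{u, v} G} {b : ∀ c, G → (ρ c).E}

/-- The vectors `x c` of the representations `ρ c` converge along `l` to the vector `x'` of a limit
formed along the cocycles `b c`, see `IsCocycleLimit`. -/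
def LimitsTo (l : Filter X) (b : ∀ c, G → (ρ c).E) {E : Type*} [NormedAddCommGroup E]
    [NormedSpace ℂ E] (ι : (G →₀ ℂ) →ₗ[ℂ] E) (x : ∀ c, (ρ c).E) (x' : E) : Prop :=
  ∀ ε > 0, ∃ a, ‖x' - ι a‖ ≤ ε ∧ ∀ᶠ c in l, ‖x c - Finsupp.linearCombination ℂ (b c) a‖ ≤ ε

theorem BddOnCompacts.exists_nonneg_bound {F : Set (BanachRep.{u, v} G)} (hF : BddOnCompacts F)
    {K : Set G} (hK : IsCompact K) : ∃ C, 0 ≤ C ∧ ∀ ρ ∈ F, ∀ g ∈ K, ‖ρ.π g‖ ≤ C := by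
  obtain ⟨C, hC⟩ := hF K hK
  exact ⟨max C 0, le_max_right _ _, fun ρ hρ g hg => (hC ρ hρ g hg).trans (le_max_left _ _)⟩

section Vectors

variable {E : Type*} [NormedAddCommGroup E] [NormedSpace ℂ E] {π : G →* (E →L[ℂ] E)}
  {ι : (G →₀ ℂ) →ₗ[ℂ] E} {x y : ∀ c, (ρ c).E} {x' y' : E}

theorem LimitsTo.add (hx : LimitsTo l b ι x x') (hy : LimitsTo l b ι y y') :
    LimitsTo l b ι (fun c => x c + y c) (x' + y') := by
  intro ε hε
  obtain ⟨a₁, ha₁, hev₁⟩ := hx (ε / 2) (half_pos hε)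
  obtain ⟨a₂, ha₂, hev₂⟩ := hy (ε / 2) (half_pos hε)
  refine ⟨a₁ + a₂, ?_, ?_⟩
  · rw [map_add, add_sub_add_comm]
    exact (norm_add_le_of_le ha₁ ha₂).trans (add_halves ε).le
  · filter_upwards [hev₁, hev₂] with c hc₁ hc₂
    rw [map_add, add_sub_add_comm]
    exact (norm_add_le_of_le hc₁ hc₂).trans (add_halves ε).le

theorem LimitsTo.neg (hx : LimitsTo l b ι x x') : LimitsTo l b ι (fun c => -x c) (-x') := by
  intro ε hε
  obtain ⟨a, ha, hev⟩ := hx ε hε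
  refine ⟨-a, ?_, hev.mono fun c hc => ?_⟩
  · rwa [map_neg, ← neg_sub', norm_neg]
  · rwa [map_neg, ← neg_sub', norm_neg]

theorem LimitsTo.sub (hx : LimitsTo l b ι x x') (hy : LimitsTo l b ι y y') :
    LimitsTo l b ι (fun c => x c - y c) (x' - y') := by
  simpa only [sub_eq_add_neg] using hx.add hy.neg

theorem LimitsTo.tendsto_norm (h : IsCocycleLimit l ρ b π ι) (hx : LimitsTo l b ι x x') :
    Tendsto (fun c => ‖x c‖) l (𝓝 ‖x'‖) := by
  refine Metric.tendsto_nhds.2 fun ε hε => ?_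
  obtain ⟨a, ha, hev⟩ := hx (ε / 3) (by positivity)
  filter_upwards [hev, Metric.tendsto_nhds.1 (h.tendsto_norm a) (ε / 3) (by positivity)]
    with c hc hca
  have hxa := (abs_norm_sub_norm_le (x c) (Finsupp.linearCombination ℂ (b c) a)).trans hc
  have hxa' := (abs_norm_sub_norm_le x' (ι a)).trans ha
  rw [Real.dist_eq, abs_lt] at *
  rw [abs_le] at hxa hxa'
  constructor <;> linarith

theorem norm_cocycle_sub_le {τ : BanachRep.{u, v} G} {β : G → τ.E} (hβ : β ∈ τ.Z1) {g g₀ : G}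
    {C η : ℝ} (hC : ‖τ.π g₀‖ ≤ C) (hη : ‖β (g₀⁻¹ * g)‖ ≤ η) : ‖β g - β g₀‖ ≤ C * η := by
  have hmul := hβ.2 g₀ (g₀⁻¹ * g)
  rw [mul_inv_cancel_left] at hmul
  rw [hmul, add_sub_cancel_left]
  exact (τ.π g₀).le_of_opNorm_le_of_le hC hη

theorem LimitsTo.cocycle [ContinuousMul G] (hb : EquicontinuousCocycles ρ b)
    {s : X → G} {s₀ : G} (hs : Tendsto s l (𝓝 s₀)) :
    LimitsTo l b ι (fun c => b c (s c)) (limitCocycle ι s₀) := by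
  intro ε hε
  obtain ⟨C, hC⟩ := hb.bddOnCompacts {s₀} isCompact_singleton
  obtain ⟨η, hη, hηε⟩ := exists_pos_mul_lt hε C
  have hs1 : Tendsto (fun c => s₀⁻¹ * s c) l (𝓝 1) := by simpa using hs.const_mul s₀⁻¹
  refine ⟨Finsupp.single s₀ 1, by simpa [limitCocycle] using hε.le, ?_⟩
  filter_upwards [hs1.eventually (hb.eventually_norm_le η hη)] with c hc
  rw [Finsupp.linearCombination_single, one_smul]
  exact (norm_cocycle_sub_le (hb.mem_Z1 c) (hC _ ⟨c, rfl⟩ _ rfl) (hc c)).trans hηε.le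

theorem norm_apply_sub_apply_le {τ : BanachRep.{u, v} G} {z w : τ.E} {g g₀ : G} {C η : ℝ}
    (hg : ‖τ.π g‖ ≤ C) (hg₀ : ‖τ.π g₀‖ ≤ C) (hzw : ‖z - w‖ ≤ η)
    (hw : ‖τ.π (g₀⁻¹ * g) w - w‖ ≤ η) : ‖τ.π g z - τ.π g₀ w‖ ≤ C * η + C * η := by
  have hsplit : τ.π g z - τ.π g₀ w = τ.π g (z - w) + τ.π g₀ (τ.π (g₀⁻¹ * g) w - w) := by
    rw [map_sub, map_sub, ← mul_apply_eq_comp, ← map_mul, mul_inv_cancel_left, sub_add_sub_cancel]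
  rw [hsplit]
  exact norm_add_le_of_le ((τ.π g).le_of_opNorm_le_of_le hg hzw)
    ((τ.π g₀).le_of_opNorm_le_of_le hg₀ hw)

theorem LimitsTo.apply [l.NeBot] [ContinuousMul G] [WeaklyLocallyCompactSpace G]
    (h : IsCocycleLimit l ρ b π ι) (hb : EquicontinuousCocycles ρ b)
    (hx : LimitsTo l b ι x x') {s : X → G} {s₀ : G} (hs : Tendsto s l (𝓝 s₀)) :
    LimitsTo l b ι (fun c => (ρ c).π (s c) (x c)) (π s₀ x') := by
  intro ε hε
  obtain ⟨K, hK, hKs₀⟩ := exists_compact_mem_nhds s₀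
  have hs₀K := mem_of_mem_nhds hKs₀
  obtain ⟨C, hC0, hC⟩ := hb.bddOnCompacts.exists_nonneg_bound hK
  obtain ⟨η, hη, hηε⟩ := exists_pos_mul_lt hε (C + C)
  obtain ⟨a, ha, hev⟩ := hx η hη
  have hs1 : Tendsto (fun c => s₀⁻¹ * s c) l (𝓝 1) := by simpa using hs.const_mul s₀⁻¹
  refine ⟨cocycleShift s₀ a, ?_, ?_⟩
  · rw [← h.map_apply, ← map_sub]
    have hπ : ‖π s₀‖ ≤ C := h.opNorm_le hb.mem_Z1 fun c => hC _ ⟨c, rfl⟩ _ hs₀K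
    have hCη : C * η ≤ (C + C) * η := by gcongr; linarith
    exact ((π s₀).le_of_opNorm_le_of_le hπ ha).trans (hCη.trans hηε.le)
  · filter_upwards [hev, hs.eventually hKs₀,
      hs1.eventually (hb.eventually_norm_apply_linearCombination_sub_le a hη)] with c hc hcK hca
    rw [linearCombination_cocycleShift (hb.mem_Z1 c)]
    exact (norm_apply_sub_apply_le (hC _ ⟨c, rfl⟩ _ hcK) (hC _ ⟨c, rfl⟩ _ hs₀K) hc (hca c)).trans
      (by linarith)

end Vectors

variable [ContinuousMul G] [T2Space G] [LocallyCompactSpace G] [MeasurableSpace G] [BorelSpace G]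
  (μ : Measure G) [IsFiniteMeasureOnCompacts μ] {ρ' : BanachRep.{u, v} G}
  {ι : (G →₀ ℂ) →ₗ[ℂ] ρ'.E}

theorem LimitsTo.barycenter [l.NeBot] (h : IsCocycleLimit l ρ b ρ'.π ι)
    (hb : EquicontinuousCocycles ρ b) (m : C_c(G, ℂ)) :
    LimitsTo l b ι (fun c => barycenter μ m (b c)) (barycenter μ m (limitCocycle ι)) := by
  intro ε hε
  obtain ⟨C, hC⟩ := hb.bddOnCompacts _ m.hasCompactSupport
  obtain ⟨η, hη, hηε⟩ := exists_pos_mul_lt hε ((∫ g, ‖m g‖ ∂μ) * C)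
  rw [mul_assoc] at hηε
  obtain ⟨P⟩ := TranslatePartition.nonempty m.hasCompactSupport.isCompact
    (hb.eventually_norm_le η hη)
  refine ⟨∑ j, P.weight μ m j • Finsupp.single (P.node j) 1, ?_, .of_forall fun c => ?_⟩
  · have hlim : limitCocycle ι ∈ ρ'.Z1 := ⟨h.continuous_limitCocycle hb, h.limitCocycle_mul⟩
    simp only [map_sum, map_smul]
    exact (P.norm_barycenter_cocycle_sub_sum_le μ hlim subset_rfl
      (fun g hg => h.opNorm_le hb.mem_Z1 fun c => hC _ ⟨c, rfl⟩ g hg)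
      fun k hk => h.norm_limitCocycle_le hk).trans hηε.le
  · simp only [map_sum, map_smul, Finsupp.linearCombination_single, one_smul]
    exact (P.norm_barycenter_cocycle_sub_sum_le μ (hb.mem_Z1 c) subset_rfl (hC _ ⟨c, rfl⟩)
      fun k hk => hk c).trans hηε.le

theorem IsCocycleLimit.eventually_norm_rebase_barycenter_lt {𝒰 : Ultrafilter X}
    (h : IsCocycleLimit 𝒰 ρ b ρ'.π ι) (hb : EquicontinuousCocycles ρ b) {S : Set G}
    (hS : IsCompact S) (m : C_c(G, ℂ)) {r : ℝ}
    (hr : ∀ s ∈ S, ‖ρ'.rebase (limitCocycle ι) (barycenter μ m (limitCocycle ι)) s‖ < r)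
    {s : X → G} (hs : ∀ c, s c ∈ S) :
    ∀ᶠ c in (𝒰 : Filter X), ‖(ρ c).rebase (b c) (barycenter μ m (b c)) (s c)‖ < r := by
  obtain ⟨s₀, hs₀, hlim⟩ := hS.ultrafilter_le_nhds (𝒰.map s)
    (le_principal_iff.2 (Filter.mem_map.2 (Filter.univ_mem' hs)))
  have hbary := LimitsTo.barycenter μ h hb m
  have hrebase := ((LimitsTo.cocycle hb hlim).add (hbary.apply h hb hlim)).sub hbary
  exact (hrebase.tendsto_norm h).eventually_lt_const (hr s₀ hs₀)

end LimitsTo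

end BanachRep

/-! ### Limits are accumulation points -/

section UniformConvergence

open Filter

theorem tendstoUniformlyOn_of_lipschitzWith {X Y Z : Type*} [PseudoEMetricSpace Y]
    [PseudoEMetricSpace Z] {l : Filter X} {F : X → Y → Z} {f : Y → Z} {C : NNReal}
    (hF : ∀ c, LipschitzWith C (F c)) {K : Set Y} (hK : IsCompact K)
    (hlim : ∀ y ∈ K, Tendsto (fun c => F c y) l (𝓝 (f y))) : TendstoUniformlyOn F f l K := by
  have hequi : EquicontinuousOn F K := fun y _ =>
    ((LipschitzWith.uniformEquicontinuous F C hF).equicontinuous y).equicontinuousWithinAt K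
  have hiff := EquicontinuousOn.tendsto_uniformOnFun_iff_pi' (𝔖 := {K}) (F := F)
    (by simpa using hK) (by simpa using hequi) l f
  refine UniformOnFun.tendsto_iff_tendstoUniformlyOn.1 (hiff.2 ?_) K rfl
  refine tendsto_pi_nhds.2 fun y => hlim y ?_
  simpa using y.2

theorem lipschitzWith_norm_map_sum {𝕜 V W I : Type*} [NormedField 𝕜] [AddCommGroup V]
    [Module 𝕜 V] [NormedAddCommGroup W] [NormedSpace 𝕜 W] [Fintype I] (L : V →ₗ[𝕜] W)
    {v : I → V} {B : I → ℝ}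
    (hB : ∀ i, ‖L (v i)‖ ≤ B i) :
    LipschitzWith (∑ i, B i).toNNReal fun a : I → 𝕜 => ‖L (∑ i, a i • v i)‖ := by
  refine LipschitzWith.of_dist_le' fun a a' => ?_
  have hdiff : L (∑ i, a i • v i) - L (∑ i, a' i • v i) = ∑ i, (a i - a' i) • L (v i) := by
    simp only [map_sum, map_smul, sub_smul, Finset.sum_sub_distrib]
  rw [Real.dist_eq, Finset.sum_mul]
  refine (abs_norm_sub_norm_le _ _).trans ?_
  rw [hdiff]
  refine norm_sum_le_of_le _ fun i _ => ?_
  rw [norm_smul, mul_comm, ← dist_eq_norm]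
  exact mul_le_mul (hB i) (dist_le_pi_dist a a' i) dist_nonneg ((norm_nonneg _).trans (hB i))

end UniformConvergence

namespace BanachRep

section IsClose

open Filter

variable {G : Type u} [Group G] [TopologicalSpace G] {X : Type*} {l : Filter X}
  {ρ : X → BanachRep.{u, v} G} {b : ∀ c, G → (ρ c).E} {ρ' : BanachRep.{u, v} G}
  {ι : (G →₀ ℂ) →ₗ[ℂ] ρ'.E}

theorem IsCocycleLimit.eventually_abs_norm_riemannSum_sub_lt (h : IsCocycleLimit l ρ b ρ'.π ι)
    (hb : EquicontinuousCocycles ρ b) {n N : ℕ} (t : Fin N → G) (a : Fin n → G →₀ ℂ) {ε : ℝ}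
    (hε : 0 < ε) :
    ∀ᶠ c in l, ∀ A : Fin n → Fin N → ℂ, (∀ k j, ‖A k j‖ ≤ 1) →
      |‖∑ k, ∑ j, A k j • (ρ c).π (t j) (Finsupp.linearCombination ℂ (b c) (a k))‖
        - ‖∑ k, ∑ j, A k j • ρ'.π (t j) (ι (a k))‖| < ε := by
  let v : Fin n × Fin N → G →₀ ℂ := fun p => cocycleShift (t p.2) (a p.1)
  choose B hB using fun p => hb.exists_norm_linearCombination_le (v p)
  have hunif := tendstoUniformlyOn_of_lipschitzWith (l := l)
    (fun c => lipschitzWith_norm_map_sum (Finsupp.linearCombination ℂ (b c)) fun p => hB p c)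
    (isCompact_closedBall (0 : Fin n × Fin N → ℂ) 1) fun A _ => h.tendsto_norm (∑ p, A p • v p)
  filter_upwards [Metric.tendstoUniformlyOn_iff.1 hunif ε hε] with c hc A hA
  have hAc := hc (fun p => A p.1 p.2) (mem_closedBall_zero_iff.2
    ((pi_norm_le_iff_of_nonneg zero_le_one).2 fun p => hA p.1 p.2))
  rw [dist_comm, Real.dist_eq] at hAc
  simpa only [v, Fintype.sum_prod_type, map_sum, map_smul, h.map_apply,
    linearCombination_cocycleShift (hb.mem_Z1 c)] using hAc

variable [IsTopologicalGroup G] [MeasurableSpace G] [BorelSpace G] {μ : Measure G}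
  [μ.IsHaarMeasure] {Q : Set G} {n : ℕ} {C η : ℝ}

theorem norm_sum_op_le {ρ : BanachRep.{u, v} G} (hC0 : 0 ≤ C) (hC : ∀ g ∈ Q, ‖ρ.π g‖ ≤ C)
    {z : Fin n → ρ.E} (hz : ∀ k, ‖z k‖ ≤ η) {f : Fin n → C_c(G, ℂ)}
    (hf : ∀ k, tsupport (f k) ⊆ Q ∧ ∫ g, ‖f k g‖ ∂μ ≤ 1) :
    ‖∑ k, ρ.op μ (f k) (z k)‖ ≤ n * (C * η) := by
  have hop : ∀ k, ‖ρ.op μ (f k) (z k)‖ ≤ C * η := fun k =>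
    (ρ.op μ (f k)).le_of_opNorm_le_of_le ((ρ.norm_op_le μ (f k) hC0 fun g hg =>
      hC g ((hf k).1 hg)).trans (mul_le_of_le_one_left hC0 (hf k).2)) (hz k)
  simpa using norm_sum_le_of_le Finset.univ fun k _ => hop k

theorem norm_sum_op_sub_riemannSum_le {ρ : BanachRep.{u, v} G} (hC0 : 0 ≤ C) (hη0 : 0 ≤ η)
    (hC : ∀ g ∈ Q, ‖ρ.π g‖ ≤ C) {U : Set G} (P : TranslatePartition Q U) {x : Fin n → ρ.E}
    (hx : ∀ k, ∀ g ∈ U, ‖ρ.π g (x k) - x k‖ ≤ η) {f : Fin n → C_c(G, ℂ)}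
    (hf : ∀ k, tsupport (f k) ⊆ Q ∧ ∫ g, ‖f k g‖ ∂μ ≤ 1) :
    ‖∑ k, ρ.op μ (f k) (x k) - ∑ k, ∑ j, P.weight μ (f k) j • ρ.π (P.node j) (x k)‖
      ≤ n * (C * η) := by
  have hterm : ∀ k, ‖ρ.op μ (f k) (x k) - ∑ j, P.weight μ (f k) j • ρ.π (P.node j) (x k)‖
      ≤ C * η := fun k =>
    (P.norm_barycenter_apply_sub_sum_le μ (hf k).1 hC (hx k)).trans
      (mul_le_of_le_one_left (by positivity) (hf k).2)
  rw [← Finset.sum_sub_distrib]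
  simpa using norm_sum_le_of_le Finset.univ fun k _ => hterm k

theorem IsClose.of_norm_sub_le {ρ ρ' : BanachRep.{u, v} G} {x y : Fin n → ρ.E} {ε : ℝ}
    (h : IsClose μ ρ y Q ε ρ') (hC0 : 0 ≤ C) (hC : ∀ g ∈ Q, ‖ρ.π g‖ ≤ C)
    (hxy : ∀ k, ‖y k - x k‖ ≤ η) : IsClose μ ρ x Q (ε + n * (C * η)) ρ' := by
  obtain ⟨x', δ, hδ, hx'⟩ := h
  refine ⟨x', δ + n * (C * η), by linarith, fun f hf => ?_⟩
  have hperturb := norm_sum_op_le hC0 hC hxy hf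
  simp only [map_sub, Finset.sum_sub_distrib] at hperturb
  exact (abs_sub_le _ _ _).trans
    (add_le_add (hx' f hf) ((abs_norm_sub_norm_le _ _).trans hperturb))

variable [T2Space G] [LocallyCompactSpace G] [l.NeBot] {ε : ℝ}

theorem IsCocycleLimit.eventually_isClose_map (h : IsCocycleLimit l ρ b ρ'.π ι)
    (hb : EquicontinuousCocycles ρ b) (a : Fin n → G →₀ ℂ) (hQ : IsCompact Q) (hε : 0 < ε) :
    ∀ᶠ c in l, IsClose μ ρ' (fun k => ι (a k)) Q ε (ρ c) := by
  obtain ⟨C, hC0, hC⟩ := hb.bddOnCompacts.exists_nonneg_bound hQ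
  have hC' : ∀ g ∈ Q, ‖ρ'.π g‖ ≤ C := fun g hg =>
    h.opNorm_le hb.mem_Z1 fun c => hC _ ⟨c, rfl⟩ g hg
  obtain ⟨η, hη, hηε⟩ := exists_pos_mul_lt hε (2 * n * C + 1)
  obtain ⟨P⟩ := TranslatePartition.nonempty hQ
    (eventually_all.2 fun k => hb.eventually_norm_apply_linearCombination_sub_le (a k) hη)
  filter_upwards [h.eventually_abs_norm_riemannSum_sub_lt hb P.node a hη] with c hc
  refine ⟨fun k => Finsupp.linearCombination ℂ (b c) (a k), _, hηε, fun f hf => ?_⟩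
  have hsum := norm_sum_op_sub_riemannSum_le hC0 hη.le (hC _ ⟨c, rfl⟩) P
    (fun k g hg => hg k c) hf
  have hsum' := norm_sum_op_sub_riemannSum_le hC0 hη.le hC' P
    (fun k g hg => h.norm_apply_sub_le hb.mem_Z1 (hg k)) hf
  have hweights := hc (fun k => P.weight μ (f k)) fun k j =>
    (P.norm_weight_le μ (f k) j).trans (hf k).2
  have hdist := (abs_norm_sub_norm_le _ _).trans hsum
  have hdist' := (abs_norm_sub_norm_le _ _).trans hsum'
  rw [abs_le] at *
  rw [abs_lt] at hweights
  constructor <;> linarith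

theorem IsCocycleLimit.eventually_isClose (h : IsCocycleLimit l ρ b ρ'.π ι)
    (hb : EquicontinuousCocycles ρ b) (x : Fin n → ρ'.E) (hQ : IsCompact Q) (hε : 0 < ε) :
    ∀ᶠ c in l, IsClose μ ρ' x Q ε (ρ c) := by
  obtain ⟨C, hC0, hC⟩ := hb.bddOnCompacts.exists_nonneg_bound hQ
  have hC' : ∀ g ∈ Q, ‖ρ'.π g‖ ≤ C := fun g hg =>
    h.opNorm_le hb.mem_Z1 fun c => hC _ ⟨c, rfl⟩ g hg
  obtain ⟨η, hη, hηε⟩ := exists_pos_mul_lt hε (n * C)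
  rw [mul_assoc] at hηε
  choose a ha using fun k => h.denseRange.exists_dist_lt (x k) hη
  filter_upwards [h.eventually_isClose_map (μ := μ) hb a hQ (sub_pos.2 hηε)] with c hc
  rw [← sub_add_cancel ε (n * (C * η))]
  refine hc.of_norm_sub_le hC0 hC' fun k => ?_
  rw [← dist_eq_norm, dist_comm]
  exact (ha k).le

end IsClose

/-! ### Smoothed cocycles -/

section Smoothing

open Filter

variable {G : Type u} [Group G] [TopologicalSpace G] [IsTopologicalGroup G]

/-- The left translate `h ↦ f(g⁻¹ h)` of `f`. -/
noncomputable def leftTranslate (g : G) (f : C_c(G, ℂ)) : C_c(G, ℂ) :=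
  f.comp (Homeomorph.mulLeft g⁻¹).toCocompactMap

theorem leftTranslate_apply (g h : G) (f : C_c(G, ℂ)) : leftTranslate g f h = f (g⁻¹ * h) := rfl

theorem leftTranslate_sub_apply_eq_zero {K : Set G} (hK1 : 1 ∈ K) {g h : G} (hg : g ∈ K)
    {f : C_c(G, ℂ)} (hh : h ∉ K * tsupport f) : (leftTranslate g f - f) h = 0 := by
  have hgh : g⁻¹ * h ∉ tsupport f := fun hmem => hh ⟨g, hg, g⁻¹ * h, hmem, by simp⟩
  have hh' : h ∉ tsupport f := fun hmem => hh ⟨1, hK1, h, hmem, by simp⟩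
  rw [CompactlySupportedContinuousMap.sub_apply, leftTranslate_apply,
    image_eq_zero_of_notMem_tsupport hgh, image_eq_zero_of_notMem_tsupport hh', sub_zero]

theorem tsupport_leftTranslate_sub_subset [T2Space G] {K : Set G} (hK : IsCompact K) (hK1 : 1 ∈ K)
    {g : G} (hg : g ∈ K) (f : C_c(G, ℂ)) : tsupport (leftTranslate g f - f) ⊆ K * tsupport f :=
  closure_minimal
    (fun _ hh => by_contra fun hmem => hh (leftTranslate_sub_apply_eq_zero hK1 hg hmem))
    (hK.mul f.hasCompactSupport.isCompact).isClosed

variable [MeasurableSpace G] [BorelSpace G] (μ : Measure G)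

theorem tendsto_integral_norm_leftTranslate_sub [WeaklyLocallyCompactSpace G]
    [IsFiniteMeasureOnCompacts μ] (f : C_c(G, ℂ)) :
    Tendsto (fun g => ∫ h, ‖(leftTranslate g f - f) h‖ ∂μ) (𝓝 1) (𝓝 0) := by
  obtain ⟨K, hK, hK1⟩ := exists_compact_mem_nhds (1 : G)
  have hcont : ContinuousOn (fun g => ∫ h, ‖(leftTranslate g f - f) h‖ ∂μ) K := by
    refine continuousOn_integral_of_compact_support (hK.mul f.hasCompactSupport.isCompact) ?_
      fun g h hg hh => by
        rw [leftTranslate_sub_apply_eq_zero (mem_of_mem_nhds hK1) hg hh, norm_zero]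
    have hshift : Continuous fun p : G × G => f (p.1⁻¹ * p.2) := f.continuous.comp (by fun_prop)
    exact (hshift.sub (f.continuous.comp continuous_snd)).norm.continuousOn
  simpa [leftTranslate_apply] using (hcont.continuousAt hK1).tendsto

variable {μ} [μ.IsHaarMeasure] {ρ : BanachRep.{u, v} G} {b : G → ρ.E} {f : C_c(G, ℂ)}

theorem barycenter_leftTranslate (g : G) :
    barycenter μ (leftTranslate g f) b = barycenter μ f fun h => b (g * h) := by
  have h := integral_mul_left_eq_self (μ := μ) (fun h => f (g⁻¹ * h) • b h) g
  simp only [inv_mul_cancel_left] at h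
  exact h.symm

theorem rebase_barycenter_apply (hb : b ∈ ρ.Z1) (hf : ∫ g, f g ∂μ = 1) (g : G) :
    ρ.rebase b (barycenter μ f b) g = barycenter μ (leftTranslate g f - f) b := by
  rw [rebase, ← barycenter_mul_left hb hf, ← barycenter_leftTranslate]
  simp only [barycenter, CompactlySupportedContinuousMap.sub_apply, sub_smul]
  exact (integral_sub (integrable_cc_smul μ _ hb.1) (integrable_cc_smul μ f hb.1)).symm

variable [T2Space G] [LocallyCompactSpace G] {S : Set G}

theorem eventually_norm_rebase_barycenter_le (hS : IsCompactGenerating S) (M : ℝ)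
    (hf : ∫ g, f g ∂μ = 1) {ε : ℝ} (hε : 0 < ε) :
    ∀ᶠ g in 𝓝 (1 : G), ∀ ρ : BanachRep.{u, v} G, (∀ s ∈ S, ‖ρ.π s‖ ≤ M) → ∀ b ∈ ρ.Z1,
      (∀ s ∈ S, ‖b s‖ ≤ 1) → ‖ρ.rebase b (barycenter μ f b) g‖ ≤ ε := by
  obtain ⟨K, hK, hK1⟩ := exists_compact_mem_nhds (1 : G)
  obtain ⟨C, -, hC⟩ := exists_norm_cocycle_le.{u, v} hS M (hK.mul f.hasCompactSupport.isCompact)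
  have hsmall := (tendsto_integral_norm_leftTranslate_sub μ f).mul_const (C * 1)
  rw [zero_mul] at hsmall
  filter_upwards [hK1, hsmall.eventually_le_const hε] with g hgK hg ρ hρ b hb hb1
  rw [rebase_barycenter_apply hb hf]
  refine (norm_barycenter_le μ fun h hh => ?_).trans hg
  exact hC ρ hρ b hb 1 hb1 h
    (tsupport_leftTranslate_sub_subset hK (mem_of_mem_nhds hK1) hgK f hh)

theorem exists_contracts_of_norm_le (hS : IsCompactGenerating S) (M : ℝ) (f : C_c(G, ℂ)) :
    ∃ C > 0, ∀ ρ : BanachRep.{u, v} G, (∀ s ∈ S, ‖ρ.π s‖ ≤ M) → Contracts μ S f C ρ := by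
  obtain ⟨C, hC0, hC⟩ := exists_norm_barycenter_le.{u, v} μ hS M f
  refine ⟨1 + (1 + |M|) * C, by positivity, fun ρ hρ b hb hb1 s hs => ?_⟩
  have hbary : ‖barycenter μ f b‖ ≤ C := by simpa using hC ρ hρ b hb 1 hb1
  have hcob := norm_coboundary_le ((hρ s hs).trans (le_abs_self M)) (barycenter μ f b)
  rw [rebase_eq_sub_coboundary]
  exact norm_sub_le_of_le (hb1 s hs) (hcob.trans (by gcongr))

theorem equicontinuousCocycles_rebase_barycenter {X : Type*} {ρ : X → BanachRep.{u, v} G}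
    {b : ∀ c, G → (ρ c).E} (hS : IsCompactGenerating S) {M : ℝ}
    (hρ : ∀ c, ∀ s ∈ S, ‖(ρ c).π s‖ ≤ M) (hb : ∀ c, b c ∈ (ρ c).Z1)
    (hb1 : ∀ c, ∀ s ∈ S, ‖b c s‖ ≤ 1) (hf : ∫ g, f g ∂μ = 1) :
    EquicontinuousCocycles ρ fun c => (ρ c).rebase (b c) (barycenter μ f (b c)) where
  bddOnCompacts := bddOnCompacts_of_forall_norm_le hS (by rintro _ ⟨c, rfl⟩; exact hρ c)
  mem_Z1 c := rebase_mem_Z1 (hb c) _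
  exists_norm_le g := by
    obtain ⟨D, -, hD⟩ := exists_contracts_of_norm_le.{u, v} (μ := μ) hS M f
    obtain ⟨C, -, hC⟩ := exists_norm_cocycle_le.{u, v} hS M (isCompact_singleton (x := g))
    exact ⟨C * D, fun c => hC _ (hρ c) _ (rebase_mem_Z1 (hb c) _) D
      (hD _ (hρ c) _ (hb c) (hb1 c)) g rfl⟩
  eventually_norm_le ε hε := by
    filter_upwards [eventually_norm_rebase_barycenter_le.{u, v} hS M hf hε] with g hg c
    exact hg _ (hρ c) _ (hb c) (hb1 c)

end Smoothing

/-! ### Strong neighbourhoods -/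

section FellTopology

variable {G : Type u} [Group G] [TopologicalSpace G] [IsTopologicalGroup G] [MeasurableSpace G]
  [BorelSpace G] {μ : Measure G} [μ.IsHaarMeasure]

theorem map_op_of_intertwines {ρ₁ ρ₂ : BanachRep.{u, v} G} (T : ρ₁.E →L[ℂ] ρ₂.E)
    (hT : ∀ g x, T (ρ₁.π g x) = ρ₂.π g (T x)) (f : C_c(G, ℂ)) (x : ρ₁.E) :
    T (ρ₁.op μ f x) = ρ₂.op μ f (T x) := by
  refine (map_barycenter μ T (ρ₁.continuous_apply x)).trans ?_
  simp only [hT]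
  rfl

theorem IsClose.exists_trans {ρ ρ₁ ρ₂ : BanachRep.{u, v} G} {n : ℕ} {x : Fin n → ρ.E} {Q : Set G}
    {ε : ℝ} (h : IsClose μ ρ x Q ε ρ₁) (h₁₂ : Equivalent ρ₁ ρ₂) :
    ∃ y : Fin n → ρ₂.E, ∃ ε' > 0, ∀ ρ₃ : BanachRep.{u, v} G, IsClose μ ρ₂ y Q ε' ρ₃ →
      IsClose μ ρ x Q ε ρ₃ := by
  obtain ⟨x₁, δ, hδ, hx₁⟩ := h
  obtain ⟨T, hT⟩ := h₁₂
  have hop : ∀ f z, T (ρ₁.op μ f z) = ρ₂.op μ f (T z) :=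
    map_op_of_intertwines (T : ρ₁.E →L[ℂ] ρ₂.E) hT
  refine ⟨fun k => T (x₁ k), ε - δ, sub_pos.2 hδ, ?_⟩
  rintro ρ₃ ⟨x₃, δ', hδ', hx₃⟩
  refine ⟨x₃, δ' + δ, by linarith, fun f hf => ?_⟩
  have hclose := hx₃ f hf
  simp only [← hop, ← map_sum, T.norm_map] at hclose
  exact (abs_sub_le _ _ _).trans (add_le_add hclose (hx₁ f hf))

theorem clusterPt_fellTopology {S : Set G} {M : ℝ} {𝒰 : Ultrafilter (RepSpace.{u, v} S M)}
    {r : RepSpace.{u, v} S M → Rep.{u, v} S M} (hr : ∀ c, (r c).cls = c) {ρ : Rep.{u, v} S M}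
    (h : ∀ (n : ℕ) (x : Fin n → ρ.1.E) (Q : Set G), IsCompact Q → ∀ ε > 0,
      ∀ᶠ c in (𝒰 : Filter (RepSpace.{u, v} S M)), IsClose μ ρ.1 x Q ε (r c).1) :
    @ClusterPt _ (fellTopology μ S M) ρ.cls (𝒰 : Filter (RepSpace.{u, v} S M)) := by
  let := fellTopology.{u, v} μ S M
  refine ClusterPt.of_le_nhds ?_
  rw [TopologicalSpace.nhds_generateFrom]
  refine le_iInf₂ fun V hV => ?_
  obtain ⟨hρV, ρ₀, n, x, Q, ε, hQ, -, rfl⟩ := hV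
  obtain ⟨ρ₁, hρ₁, hclose⟩ := hρV
  obtain ⟨y, ε', hε', hy⟩ := hclose.exists_trans (Quotient.exact hρ₁ : Equivalent ρ₁.1 ρ.1)
  refine Filter.le_principal_iff.2 ?_
  filter_upwards [h n y Q hQ ε' hε'] with c hc
  exact ⟨r c, hr c, hy _ hc⟩

end FellTopology

section StrongNeighbourhood

open Filter

theorem norm_le_of_mem_reps {G : Type u} [Group G] [TopologicalSpace G] {S : Set G} {M : ℝ}
    {F : Set (RepSpace.{u, v} S M)} {ρ : BanachRep.{u, v} G} (hρ : ρ ∈ RepSpace.reps F) :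
    ∀ g ∈ S, ‖ρ.π g‖ ≤ M := by
  obtain ⟨ρ', rfl, -⟩ := hρ
  exact ρ'.2.2

variable {G : Type u} [Group G] [TopologicalSpace G] [MeasurableSpace G] (μ : Measure G)
  {S : Set G} {M : ℝ}

/-- The classes of the representations for which averaging by `m` contracts displacements by the
factor `κ`. -/
def contractedClasses (S : Set G) (M : ℝ) (m : C_c(G, ℂ)) (κ : ℝ) : Set (RepSpace.{u, v} S M) :=
  {c | ∀ ρ : Rep.{u, v} S M, ρ.cls = c → Contracts μ S m κ ρ.1}

variable {μ} {κ : ℝ} {m : C_c(G, ℂ)}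

theorem contracts_of_mem_reps {ρ : BanachRep.{u, v} G}
    (hρ : ρ ∈ RepSpace.reps (contractedClasses μ S M m κ)) : Contracts μ S m κ ρ := by
  obtain ⟨ρ', rfl, hρ'⟩ := hρ
  exact hρ' ρ' rfl

theorem exists_uncontracted_cocycle (hS : S.Nonempty) (c : RepSpace.{u, v} S M) :
    ∃ (r : Rep.{u, v} S M) (b : G → r.1.E) (s : G), r.cls = c ∧ b ∈ r.1.Z1 ∧
      (∀ t ∈ S, ‖b t‖ ≤ 1) ∧ s ∈ S ∧
        (c ∉ contractedClasses μ S M m κ → κ < ‖r.1.rebase b (barycenter μ m b) s‖) := by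
  by_cases hc : c ∈ contractedClasses μ S M m κ
  · obtain ⟨r, hr⟩ := Quotient.exists_rep c
    obtain ⟨s, hs⟩ := hS
    exact ⟨r, 0, s, hr, r.1.Z1.zero_mem, by simp, hs, fun h => absurd hc h⟩
  · have hbad := hc
    simp only [contractedClasses, Set.mem_ofPred_eq, Contracts, not_forall, not_le] at hbad
    obtain ⟨r, hr, b, hb, hb1, s, hs, hlt⟩ := hbad
    exact ⟨r, b, s, hr, hb, hb1, hs, fun _ => hlt⟩

variable [IsTopologicalGroup G] [T2Space G] [LocallyCompactSpace G]
  [TopologicalSpace.SeparableSpace G] [BorelSpace G] [μ.IsHaarMeasure]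

theorem eventually_norm_rebase_barycenter_lt_of_clusterPt {F : Set (RepSpace.{u, v} S M)}
    (hF : ∀ ρ ∈ RepSpace.reps F, Contracts μ S m κ ρ) {𝒰 : Ultrafilter (RepSpace.{u, v} S M)}
    (h𝒰 : ∀ c, @ClusterPt _ (fellTopology μ S M) c (𝒰 : Filter (RepSpace.{u, v} S M)) → c ∈ F)
    {r : RepSpace.{u, v} S M → Rep.{u, v} S M} (hr : ∀ c, (r c).cls = c)
    {b : ∀ c, G → (r c).1.E} (hb : EquicontinuousCocycles (fun c => (r c).1) b)
    (hS : IsCompact S) {D κ' : ℝ} (hD : ∀ c, ∀ s ∈ S, ‖b c s‖ ≤ D) (hκ : κ * D < κ')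
    {s : RepSpace.{u, v} S M → G} (hs : ∀ c, s c ∈ S) :
    ∀ᶠ c in (𝒰 : Filter (RepSpace.{u, v} S M)),
      ‖(r c).1.rebase (b c) (barycenter μ m (b c)) (s c)‖ < κ' := by
  obtain ⟨ρ', ι, hsep, hlim⟩ := hb.exists_separable_limit 𝒰
  have hM : ∀ g ∈ S, ‖ρ'.π g‖ ≤ M := fun g hg =>
    hlim.opNorm_le hb.mem_Z1 fun c => (r c).2.2 g hg
  have hcluster := clusterPt_fellTopology (μ := μ) (𝒰 := 𝒰) hr (ρ := ⟨ρ', hsep, hM⟩)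
    fun _ x _ hQ _ hε => hlim.eventually_isClose hb x hQ hε
  have hcontracts := hF ρ' ⟨⟨ρ', hsep, hM⟩, rfl, h𝒰 _ hcluster⟩
  refine hlim.eventually_norm_rebase_barycenter_lt μ hb hS m (fun t ht => ?_) hs
  exact (hcontracts.norm_rebase_barycenter_le
    ⟨hlim.continuous_limitCocycle hb, hlim.limitCocycle_mul⟩
    (fun t ht => hlim.norm_limitCocycle_le fun c => hD c t ht) ht).trans_lt hκ

theorem isStrongNhd_contractedClasses (hS : IsCompactGenerating S) {f : C_c(G, ℂ)}
    (hf : ∫ g, f g ∂μ = 1) {C : ℝ}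
    (hC : ∀ ρ : BanachRep.{u, v} G, (∀ s ∈ S, ‖ρ.π s‖ ≤ M) → Contracts μ S f C ρ)
    (hm : ∫ g, m g ∂μ = 1) {κ' : ℝ} (hκ : κ * C < κ') {F : Set (RepSpace.{u, v} S M)}
    (hF : ∀ ρ ∈ RepSpace.reps F, Contracts μ S m κ ρ) :
    IsStrongNhd (fellTopology μ S M) (contractedClasses μ S M (conv μ m f) κ') F := by
  intro 𝒰 h𝒰
  by_contra hnot
  choose r b s hr hb hb1 hs hbad using fun c : RepSpace.{u, v} S M =>
    exists_uncontracted_cocycle (μ := μ) (m := conv μ m f) (κ := κ') ⟨1, hS.one_mem⟩ c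
  have hρ : ∀ c, ∀ t ∈ S, ‖(r c).1.π t‖ ≤ M := fun c => (r c).2.2
  have hequi := equicontinuousCocycles_rebase_barycenter hS hρ hb hb1 hf
  have hsmall := eventually_norm_rebase_barycenter_lt_of_clusterPt hF h𝒰 hr hequi hS.isCompact
    (fun c => hC _ (hρ c) _ (hb c) (hb1 c)) hκ hs
  obtain ⟨c, hc, hcmem⟩ := (hsmall.and (Ultrafilter.compl_mem_iff_notMem.2 hnot)).exists
  rw [rebase_rebase, ← barycenter_conv_cocycle (hb c) hm hf] at hc
  exact (hbad c hcmem).not_gt hc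

end StrongNeighbourhood

end BanachRep

theorem theorem4p1_general {G : Type u} [Group G] [TopologicalSpace G] [IsTopologicalGroup G]
    [T2Space G] [LocallyCompactSpace G] [TopologicalSpace.SeparableSpace G]
    [MeasurableSpace G] [BorelSpace G] (μ : Measure G) [μ.IsHaarMeasure]
    {S : Set G} (hS : IsCompactGenerating S) (M : ℝ) (F : Set (BanachRep.RepSpace.{u, v} S M))
    (hF : BanachRep.HasKazhdanProjection μ (BanachRep.RepSpace.reps F))
    (hF_H1 : ∀ ρ ∈ BanachRep.RepSpace.reps F, Subsingleton ρ.H1) :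
    ∃ F' : Set (BanachRep.RepSpace.{u, v} S M),
      IsStrongNhd (BanachRep.fellTopology μ S M) F' F ∧
      BanachRep.HasKazhdanProjection μ (BanachRep.RepSpace.reps F') ∧
      ∀ ρ ∈ BanachRep.RepSpace.reps F', Subsingleton ρ.H1 := by
  have hcontracts : ∀ κ > 0, ∃ m : C_c(G, ℂ), ∫ g, m g ∂μ = 1 ∧
      ∀ ρ ∈ BanachRep.RepSpace.reps F, BanachRep.Contracts μ S m κ ρ := fun κ hκ =>
    hF.exists_contracts hS (fun ρ => BanachRep.norm_le_of_mem_reps) hF_H1 hκ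
  obtain ⟨f, hf, -⟩ := hcontracts 1 one_pos
  obtain ⟨C, -, hC⟩ := BanachRep.exists_contracts_of_norm_le.{u, v} (μ := μ) hS M f
  obtain ⟨κ, hκ, hκC⟩ := exists_pos_mul_lt (one_half_pos (α := ℝ)) C
  obtain ⟨m, hm, hmF⟩ := hcontracts κ hκ
  have hmf : ∫ g, BanachRep.conv μ m f g ∂μ = 1 := by
    rw [BanachRep.integral_conv, hm, hf, mul_one]
  refine ⟨BanachRep.contractedClasses μ S M (BanachRep.conv μ m f) (1 / 2),
    BanachRep.isStrongNhd_contractedClasses hS hf hC hm (by rwa [mul_comm]) hmF, ?_,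
    fun ρ hρ => ?_⟩
  · exact BanachRep.hasKazhdanProjection_of_contracts hS
      (fun ρ => BanachRep.norm_le_of_mem_reps) hmf one_half_pos.le one_half_lt_one
      fun ρ => BanachRep.contracts_of_mem_reps
  · obtain ⟨C', -, hC'⟩ := BanachRep.exists_norm_barycenter_le.{u, v} μ hS M
      (BanachRep.conv μ m f)
    exact (BanachRep.contracts_of_mem_reps hρ).subsingleton_H1 hS.isCompact hS.closure_eq_top
      one_half_pos.le one_half_lt_one (hC' ρ (BanachRep.norm_le_of_mem_reps hρ))

theorem theorem4p1 {G : Type u} [Group G] [TopologicalSpace G] [IsTopologicalGroup G]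
    [T2Space G] [LocallyCompactSpace G] [TopologicalSpace.SeparableSpace G]
    [MeasurableSpace G] [BorelSpace G] (μ : Measure G) [μ.IsHaarMeasure]
    (S : Set G) (hS_compact : IsCompact S) (hS_symm : S⁻¹ = S) (hS_one : (1 : G) ∈ S)
    (hS_gen : Subgroup.closure S = ⊤)
    (M : ℝ) (hM : 1 < M) (F : Set (BanachRep.RepSpace.{u, v} S M))
    (hF : BanachRep.HasKazhdanProjection μ (BanachRep.RepSpace.reps F))
    (hF_H1 : ∀ ρ ∈ BanachRep.RepSpace.reps F, Subsingleton ρ.H1) :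
    ∃ F' : Set (BanachRep.RepSpace.{u, v} S M),
      IsStrongNhd (BanachRep.fellTopology μ S M) F' F ∧
      BanachRep.HasKazhdanProjection μ (BanachRep.RepSpace.reps F') ∧
      ∀ ρ ∈ BanachRep.RepSpace.reps F', Subsingleton ρ.H1 :=
  theorem4p1_general μ ⟨hS_compact, hS_symm, hS_one, hS_gen⟩ M F hF hF_H1
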